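/- Let $\alpha\ge 1$ be an integer. A plane partition is a finite set $P$ of points $(i,j,k)$ with positive integer coordinates such that $(i,j,k)\in P$, $1\le i'\le i$, $1\le j'\le j$, $1\le k'\le k$ imply $(i',j',k')\in P$. It is totally symmetric if it is closed under all permutations of the three coordinates, and a plane partition contained in the box $\{1,\dots,2\alpha\}^3$ is self-complementary if, for every point $(i,j,k)$ of the box, exactly one of $(i,j,k)$ and $(2\alpha+1-i,2\alpha+1-j,2\alpha+1-k)$ belongs to $P$. A half orbit is the set of all points obtained from a point of the box by permuting its coordinates. Let $P_0$ be the totally symmetric self-complementary plane partition consisting of the points of the box at least two of whose coordinates are at most $\alpha$, and for a totally symmetric self-complementary plane partition $P$ in the box let $n(P)$ be the number of half orbits contained in $P$ and not contained in $P_0$. Then $$\sum_{P}(-1)^{n(P)}=\begin{cases}\displaystyle\prod_{k=1}^{(\alpha-1)/2}\frac{(6k-2)!}{(2k+\alpha-1)!}&\text{for }\alpha\text{ odd},\\[2ex]0&\text{for }\alpha\text{ even},\end{cases}$$ where the sum is over all totally symmetric self-complementary plane partitions $P$ contained in the box with sides $2\alpha\times2\alpha\times2\alpha$. -/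

import Mathlib

/-- A plane partition, as a finite set of points (midpoints of unit cubes) with positive integer
coordinates, closed under decreasing coordinates. -/
structure IsPlanePartition (P : Finset (ℕ × ℕ × ℕ)) : Prop where
  pos : ∀ i j k, (i, j, k) ∈ P → 0 < i ∧ 0 < j ∧ 0 < k
  down : ∀ i j k i' j' k', (i, j, k) ∈ P → 1 ≤ i' → i' ≤ i → 1 ≤ j' → j' ≤ j → 1 ≤ k' → k' ≤ k →
    (i', j', k') ∈ P

/-- The box with side lengths `a`, `b`, `c`. -/
def box (a b c : ℕ) : Finset (ℕ × ℕ × ℕ) :=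
  Finset.Icc 1 a ×ˢ (Finset.Icc 1 b ×ˢ Finset.Icc 1 c)

def IsSymmetricPP (P : Finset (ℕ × ℕ × ℕ)) : Prop :=
  ∀ i j k, (i, j, k) ∈ P → (j, i, k) ∈ P

def IsCyclicallySymmetricPP (P : Finset (ℕ × ℕ × ℕ)) : Prop :=
  ∀ i j k, (i, j, k) ∈ P → (j, k, i) ∈ P

def IsTotallySymmetricPP (P : Finset (ℕ × ℕ × ℕ)) : Prop :=
  IsSymmetricPP P ∧ IsCyclicallySymmetricPP P

/-- `P` is self-complementary in the box with sides `a`, `b`, `c`: of a cube of the box and its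
image under the point reflection of the box, exactly one belongs to `P`. -/
def IsSelfComplementaryPP (a b c : ℕ) (P : Finset (ℕ × ℕ × ℕ)) : Prop :=
  ∀ i j k, (i, j, k) ∈ box a b c →
    ((i, j, k) ∈ P ↔ (a + 1 - i, b + 1 - j, c + 1 - k) ∉ P)

open Classical in
/-- The totally symmetric self-complementary plane partitions contained in the box with sides
`2α`, `2α`, `2α`. -/
noncomputable def tsscpp (α : ℕ) : Finset (Finset (ℕ × ℕ × ℕ)) :=
  (box (2 * α) (2 * α) (2 * α)).powerset.filter fun P =>
    IsPlanePartition P ∧ IsTotallySymmetricPP P ∧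
      IsSelfComplementaryPP (2 * α) (2 * α) (2 * α) P

/-- The half orbit of a cube: all cubes obtained from it by permuting the coordinates. The orbit of
the cube under the whole symmetry group (permutations and complementation) is the disjoint union of
its half orbit and the half orbit of the complementary cube. -/
def halfOrbit (p : ℕ × ℕ × ℕ) : Finset (ℕ × ℕ × ℕ) :=
  {(p.1, p.2.1, p.2.2), (p.2.1, p.2.2, p.1), (p.2.2, p.1, p.2.1),
    (p.2.1, p.1, p.2.2), (p.1, p.2.2, p.2.1), (p.2.2, p.2.1, p.1)}

/-- The reference partition, which gets weight 1: the cubes of the `2α × 2α × 2α` box at least two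
of whose coordinates are at most `α`. As an array of stacks it consists of four `α × α` blocks, of
heights `2α`, `α`, `α` and `0`. -/
def referencePartition (α : ℕ) : Finset (ℕ × ℕ × ℕ) :=
  (box (2 * α) (2 * α) (2 * α)).filter fun p =>
    (p.1 ≤ α ∧ p.2.1 ≤ α) ∨ (p.1 ≤ α ∧ p.2.2 ≤ α) ∨ (p.2.1 ≤ α ∧ p.2.2 ≤ α)

/-- The number of half orbits contained in `P` and not contained in the reference partition. -/
def halfOrbitCount (α : ℕ) (P : Finset (ℕ × ℕ × ℕ)) : ℕ :=
  (((box (2 * α) (2 * α) (2 * α)).image halfOrbit).filter fun h =>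
    h ⊆ P ∧ ¬ h ⊆ referencePartition α).card

/-- The `(-1)`-enumeration of totally symmetric self-complementary plane partitions in the box with
sides `2α`, `2α`, `2α`. -/
noncomputable def signedEnumTSSCPP (α : ℕ) : ℤ :=
  ∑ P ∈ tsscpp α, (-1) ^ halfOrbitCount α P

/-!
Why the theorem holds. In a totally symmetric self-complementary plane partition the sorted triples
`(i, j, k)` with `j ≤ α` are determined by those with `α < j`. The latter all satisfy
`i + k ≤ 2 * α`, since otherwise the complementary triple would be smaller and belong to the
partition, too; and under this condition self-complementarity puts no further restriction on them.
So the partitions correspond to the order ideals `I` of a tetrahedral poset, and the number of half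
orbits outside of the reference partition is the cardinality of `I` (`signedEnumTSSCPP_eq`).

Peeling off the layers of an ideal one by one turns it into a family of nonintersecting lattice
paths with free end points, one for each `r < n`, where `n = α - 1`. With the signs, the paths of
index `r` have the generating function `f_r = X ^ r * (1 - X) ^ (r / 2 + 1) * (1 + X) ^ ((r + 1) / 2)`
(`sum_tetIdeals_eq_det`), and the signed enumeration is the sum of all maximal minors of the matrix
of the coefficients of `f_0, …, f_{n - 1}` (`sum_tetIdeals`). The sign `-1` makes the parity visible:
`f_{2 l}` is `(1 - X) * g (X ^ 2)` and `f_{2 l + 1}` is `X * e (X ^ 2)` with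
`g = u ^ l * (1 - u) ^ l` and `e = u ^ l * (1 - u) ^ (l + 1)`. In the sum of the minors, the two
opposite entries of an even row in the columns `2 * k` and `2 * k + 1` cancel unless an odd row uses
the column `2 * k + 1`. Hence the even rows are matched with odd rows (`pairSign_eq_det`). There are
too many even rows if `n` is odd; this is the case of even `α`. For `n = 2 * m` the sum collapses to
the `m × m` determinant of the inner products of the coefficient sequences of the polynomials `g`
and `e`. By the Vandermonde convolution these are, up to sign, the numbers
`(i + j + 1).choose (2 * i - j)` (`sum_tetIdeals_even`).

This is a determinant of Mills, Robbins and Rumsey. It is evaluated by exhibiting a hypergeometric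
combination of the columns which vanishes in all rows but the last one; both this and the value in
the last row follow from a first-order recurrence in the row index, found by Zeilberger's algorithm
(`colSum_succ`, `det_mrrMatrix`).
-/

/-! ### The Mills-Robbins-Rumsey determinant -/

/-- The reciprocal factorial `1 / z!` of an integer, with value `0` at negative integers. -/
def recipFactorial (z : ℤ) : ℚ := if z < 0 then 0 else 1 / (Nat.factorial z.toNat : ℚ)

lemma recipFactorial_natCast (n : ℕ) : recipFactorial (n : ℤ) = 1 / (Nat.factorial n : ℚ) := by
  simp [recipFactorial]

lemma recipFactorial_of_neg {z : ℤ} (hz : z < 0) : recipFactorial z = 0 := by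
  simp [recipFactorial, hz]

/-- With the convention `1 / z! = 0` for negative `z`, this rule holds for all integers, so that
identities between binomial coefficients need no case distinctions at the boundary. -/
lemma recipFactorial_sub_one (z : ℤ) : recipFactorial (z - 1) = z * recipFactorial z := by
  rcases lt_trichotomy z 0 with h | h | h
  · rw [recipFactorial_of_neg h, recipFactorial_of_neg (by omega), mul_zero]
  · subst h; simp [recipFactorial]
  · obtain ⟨n, rfl⟩ : ∃ n : ℕ, z = n + 1 := ⟨(z - 1).toNat, by omega⟩
    have : ((n : ℤ) + 1) = ((n + 1 : ℕ) : ℤ) := by push_cast; ring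
    rw [add_sub_cancel_right, this, recipFactorial_natCast, recipFactorial_natCast,
      Nat.factorial_succ]
    have := Nat.factorial_ne_zero n
    push_cast
    field_simp

/-- The binomial coefficient `(i + j + 1).choose (2 * i - j)`, which is `0` for `2 * i < j`. -/
def skewBinom (i j : ℕ) : ℚ := if j ≤ 2 * i then ((i + j + 1).choose (2 * i - j) : ℚ) else 0

lemma skewBinom_eq (i j : ℕ) : skewBinom i j =
    (Nat.factorial (i + j + 1) : ℚ) * recipFactorial (2 * i - j) * recipFactorial (2 * j - i + 1) := by
  unfold skewBinom
  split_ifs with h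
  · obtain ⟨d, hd⟩ := Nat.exists_eq_add_of_le h
    have h1 : (2 * i - j : ℤ) = (d : ℕ) := by omega
    have h1' : 2 * i - j = d := by omega
    rw [h1, h1', recipFactorial_natCast]
    rcases lt_or_ge (2 * j + 1) i with h2 | h2
    · rw [recipFactorial_of_neg (z := 2 * j - i + 1) (by omega), mul_zero,
        Nat.choose_eq_zero_of_lt (by omega), Nat.cast_zero]
    · obtain ⟨e, he⟩ := Nat.exists_eq_add_of_le h2
      have h3 : (2 * j - i + 1 : ℤ) = (e : ℕ) := by omega
      have h4 : i + j + 1 = d + e := by omega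
      rw [h3, recipFactorial_natCast, h4, Nat.cast_add_choose]
      field_simp
  · rw [recipFactorial_of_neg (z := 2 * i - j) (by omega)]; ring

/-- The hypergeometric factor of the coefficients `colCoeff`. -/
def colCoeffAux (m : ℕ) : ℕ → ℚ
  | 0 => 1
  | j + 1 => -2 * (m - j) * (2 * m + 2 * j + 3) / ((2 * m - 1 - j) * (2 * m + j + 4)) *
      colCoeffAux m j

/-- The coefficients, for `1 ≤ m`, of a combination of the columns `0, …, m` of the matrix `skewBinom`
which vanishes in the rows `0, …, m - 1`. -/
def colCoeff (m j : ℕ) : ℚ := j * (j + 1) * colCoeffAux m j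

lemma colCoeffAux_eq_zero {m j : ℕ} (h : m < j) : colCoeffAux m j = 0 := by
  induction j, h using Nat.le_induction with
  | base => simp [colCoeffAux]
  | succ j _ ih => simp [colCoeffAux, ih]

lemma colCoeffAux_succ {m : ℕ} (hm : 1 ≤ m) (j : ℕ) :
    (2 * m - 1 - j : ℚ) * (2 * m + j + 4) * colCoeffAux m (j + 1) =
      -2 * (m - j) * (2 * m + 2 * j + 3) * colCoeffAux m j := by
  rcases lt_trichotomy j m with h | h | h
  · have h1 : (2 * m - 1 - j : ℚ) ≠ 0 := by
      have : (j : ℚ) + 1 ≤ m := by exact_mod_cast h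
      have : (1 : ℚ) ≤ m := by exact_mod_cast hm
      linarith
    have h2 : (2 * m + j + 4 : ℚ) ≠ 0 := by positivity
    rw [colCoeffAux]
    field_simp
  · subst h
    rw [colCoeffAux_eq_zero (Nat.lt_succ_self _)]; ring
  · rw [colCoeffAux_eq_zero h, colCoeffAux_eq_zero (Nat.lt_succ_of_lt h)]; ring

lemma colCoeffAux_ne_zero {m : ℕ} (hm : 1 ≤ m) {j : ℕ} (h : j ≤ m) : colCoeffAux m j ≠ 0 := by
  induction j with
  | zero => simp [colCoeffAux]
  | succ j ih =>
    have h1 : (j : ℚ) + 1 ≤ m := by exact_mod_cast h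
    have := colCoeffAux_succ hm j
    intro h0
    rw [h0, mul_zero] at this
    have h2 : (m - j : ℚ) ≠ 0 := by linarith
    have h3 : (2 * m + 2 * j + 3 : ℚ) ≠ 0 := by positivity
    have := ih (by omega)
    simp_all

/-- The image of the vector `colCoeff m` in row `i`. -/
def colSum (m i : ℕ) : ℚ := ∑ j ∈ Finset.range (m + 1), skewBinom i j * colCoeff m j

/-- The companion of the summand of `colSum m i` produced by Zeilberger's algorithm: the
combination of `colSum m i` and `colSum m (i + 1)` in `colSum_succ` telescopes to it. -/
def zeilbergerCert (m i j : ℕ) : ℚ :=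
  ((9 * i ^ 2 + 21 * i + 14) * j ^ 2 - (3 * i + 2) * (i + 3) * j - 4 * (i + 1) * (i + 2)) *
    ((2 * j - i) * (2 * j - i + 1) * (2 * m - j) * (2 * m + j + 3)) *
    (Nat.factorial (i + j + 1) * recipFactorial (2 * i + 2 - j) * recipFactorial (2 * j + 1 - i)) *
    colCoeffAux m j

lemma zeilbergerCert_succ_sub {m : ℕ} (hm : 1 ≤ m) (i j : ℕ) :
    zeilbergerCert m i (j + 1) - zeilbergerCert m i j =
      -(3 * (3 * i + 5) * (i + 2) * (2 * m + 1 - i) * (2 * m + 2 + i)) *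
        (skewBinom i j * colCoeff m j) -
      6 * (3 * i + 2) * (i + 1) * (m - 1 - i) * (2 * m + 5 + 2 * i) *
        (skewBinom (i + 1) j * colCoeff m j) := by
  have hc := colCoeffAux_succ hm j
  rw [skewBinom_eq, skewBinom_eq]
  unfold zeilbergerCert colCoeff
  have e1 : recipFactorial (2 * i - j) = (2 * i - j + 1) * ((2 * i - j + 2) *
      recipFactorial (2 * i + 2 - j)) := by
    have h1 := recipFactorial_sub_one (2 * i + 2 - j)
    have h2 := recipFactorial_sub_one (2 * i + 2 - j - 1)
    rw [h1, show (2 * i + 2 - j - 1 - 1 : ℤ) = 2 * i - j by ring] at h2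
    rw [h2]; push_cast; ring
  have e2 : recipFactorial (2 * (j : ℤ) - (i + 1 : ℕ) + 1) = (2 * j - i + 1) *
      recipFactorial (2 * j + 1 - i) := by
    have h1 := recipFactorial_sub_one (2 * j + 1 - i)
    rw [show (2 * (j : ℤ) - (i + 1 : ℕ) + 1) = 2 * j + 1 - i - 1 by push_cast; ring, h1]
    push_cast; ring
  have e3 : recipFactorial (2 * i + 2 - (j + 1 : ℕ)) = (2 * i + 2 - j) *
      recipFactorial (2 * i + 2 - j) := by
    have h1 := recipFactorial_sub_one (2 * i + 2 - j)
    rw [show (2 * (i : ℤ) + 2 - (j + 1 : ℕ)) = 2 * i + 2 - j - 1 by push_cast; ring, h1]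
    push_cast; ring
  have e4 : (2 * j + 2 - i) * ((2 * j + 3 - i) * recipFactorial (2 * (j + 1 : ℕ) + 1 - i)) =
      recipFactorial (2 * j + 1 - i) := by
    have h1 := recipFactorial_sub_one (2 * j + 3 - i)
    have h2 := recipFactorial_sub_one (2 * j + 3 - i - 1)
    rw [h1, show (2 * j + 3 - i - 1 - 1 : ℤ) = 2 * j + 1 - i by ring] at h2
    rw [h2, show (2 * ((j + 1 : ℕ) : ℤ) + 1 - i) = 2 * j + 3 - i by push_cast; ring]
    push_cast; ring
  have e5 : recipFactorial (2 * ((i + 1 : ℕ) : ℤ) - j) = recipFactorial (2 * i + 2 - j) := by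
    congr 1
  have e6 : recipFactorial (2 * (j : ℤ) - i + 1) = recipFactorial (2 * j + 1 - i) := by
    congr 1; ring
  have f1 : (Nat.factorial (i + (j + 1) + 1) : ℚ) = (i + j + 2) * Nat.factorial (i + j + 1) := by
    rw [show i + (j + 1) + 1 = (i + j + 1) + 1 by ring, Nat.factorial_succ]; push_cast; ring
  have f2 : (Nat.factorial (i + 1 + j + 1) : ℚ) = (i + j + 2) * Nat.factorial (i + j + 1) := by
    rw [show i + 1 + j + 1 = (i + j + 1) + 1 by ring, Nat.factorial_succ]; push_cast; ring
  rw [e1, e2, e3, e5, e6, f1, f2]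
  generalize recipFactorial (2 * i + 2 - j) = a at *
  generalize (Nat.factorial (i + j + 1) : ℚ) = f at *
  rw [← e4]
  generalize recipFactorial (2 * (j + 1 : ℕ) + 1 - i) = b at *
  push_cast
  generalize (i : ℚ) = i at *
  generalize (j : ℚ) = x at *
  generalize (m : ℚ) = m at *
  linear_combination ((9 * i ^ 2 + 21 * i + 14) * (x + 1) ^ 2 - (3 * i + 2) * (i + 3) * (x + 1) -
    4 * (i + 1) * (i + 2)) * ((2 * x + 2 - i) * (2 * x + 3 - i)) * ((i + x + 2) * f *
    ((2 * i + 2 - x) * a) * b) * hc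

lemma colSum_succ {m : ℕ} (hm : 1 ≤ m) (i : ℕ) :
    (3 * i + 5) * (i + 2) * (2 * m + 1 - i) * (2 * m + 2 + i) * colSum m i =
      2 * (3 * i + 2) * (i + 1) * (i + 1 - m) * (2 * m + 5 + 2 * i) * colSum m (i + 1) := by
  have h := Finset.sum_range_sub (zeilbergerCert m i) (m + 1)
  have h1 : zeilbergerCert m i (m + 1) = 0 := by
    simp [zeilbergerCert, colCoeffAux_eq_zero (Nat.lt_succ_self m)]
  have h2 : zeilbergerCert m i 0 = 0 := by
    unfold zeilbergerCert
    rcases lt_or_ge i 2 with hi | hi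
    · interval_cases i <;> simp
    · rw [recipFactorial_of_neg (z := 2 * (0 : ℕ) + 1 - i) (by push_cast; omega)]; ring
  rw [h1, h2, Finset.sum_congr rfl fun j _ => zeilbergerCert_succ_sub hm i j,
    Finset.sum_sub_distrib, ← Finset.mul_sum, ← Finset.mul_sum] at h
  change _ * colSum m i - _ * colSum m (i + 1) = _ at h
  linear_combination (-1 / 3) * h

/-- Going up from row `0`, where the sum is `0`, by the recurrence `colSum_succ`; its factor
`i + 1 - m` vanishes only in the step from row `m - 1` to row `m`. -/
lemma colSum_eq_zero {m i : ℕ} (h : i < m) : colSum m i = 0 := by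
  have hm : 1 ≤ m := by omega
  induction i with
  | zero =>
    unfold colSum
    refine Finset.sum_eq_zero fun j _ => ?_
    rcases Nat.eq_zero_or_pos j with rfl | hj
    · simp [colCoeff]
    · simp [skewBinom, hj.ne']
  | succ i ih =>
    have h1 := colSum_succ hm i
    rw [ih (by omega), mul_zero] at h1
    have : (i : ℚ) + 1 + 1 ≤ m := by exact_mod_cast h
    have h2 : (i + 1 - m : ℚ) ≠ 0 := by linarith
    have h3 : (3 * i + 2 : ℚ) ≠ 0 := by positivity
    have h4 : (i + 1 : ℚ) ≠ 0 := by positivity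
    have h5 : (2 * m + 5 + 2 * i : ℚ) ≠ 0 := by positivity
    simp_all

lemma colSum_two_mul_add_one (m : ℕ) : colSum m (2 * m + 1) = colCoeff m m := by
  unfold colSum
  rw [Finset.sum_range_succ, Finset.sum_eq_zero, zero_add]
  · rw [skewBinom, if_pos (by omega), show 2 * m + 1 + m + 1 = 2 * (2 * m + 1) - m by omega,
      Nat.choose_self, Nat.cast_one, one_mul]
  · intro j hj
    rw [Finset.mem_range] at hj
    rw [skewBinom, if_pos (by omega), Nat.choose_eq_zero_of_lt (by omega), Nat.cast_zero, zero_mul]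

/-- The value of `colSum m (m + s)`, going down from row `2 * m + 1`, in which only the last column
contributes, by the recurrence `colSum_succ`. -/
lemma colSum_mul_factorials {m : ℕ} (hm : 1 ≤ m) (t : ℕ) : ∀ s : ℕ, s + t = m + 1 →
    colSum m (m + s) * ((6 * m + 5) * (2 * m + 2) * Nat.factorial s * Nat.factorial t *
      Nat.factorial (4 * m + 2) * Nat.factorial (4 * m + 2 * s + 4) * Nat.factorial (3 * m + 3)) =
    colCoeff m m * ((3 * (m + s) + 2) * (m + s + 1) * Nat.factorial (m + 1) *
      Nat.factorial (3 * m + 1 + s) * Nat.factorial (6 * m + 6) *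
      Nat.factorial (2 * m + s + 2)) := by
  induction t with
  | zero =>
    intro s hs
    obtain rfl : s = m + 1 := by omega
    rw [show m + (m + 1) = 2 * m + 1 by ring, colSum_two_mul_add_one,
      show 4 * m + 2 * (m + 1) + 4 = 6 * m + 6 by ring,
      show 3 * m + 1 + (m + 1) = 4 * m + 2 by ring, show 2 * m + (m + 1) + 2 = 3 * m + 3 by ring]
    push_cast [Nat.factorial_zero]
    ring
  | succ t ih =>
    intro s hs
    have h := ih (s + 1) (by omega)
    have hr := colSum_succ hm (m + s)
    have ht : (2 * m + 1 - (m + s : ℕ) : ℚ) = t + 1 := by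
      have : (s : ℚ) + (t + 1) = m + 1 := by exact_mod_cast hs
      push_cast; linarith
    rw [ht] at hr
    rw [show 4 * m + 2 * (s + 1) + 4 = (4 * m + 2 * s + 4) + 1 + 1 by ring,
      show 3 * m + 1 + (s + 1) = (3 * m + 1 + s) + 1 by ring,
      show 2 * m + (s + 1) + 2 = (2 * m + s + 2) + 1 by ring,
      show m + (s + 1) = m + s + 1 by ring] at h
    simp only [Nat.factorial_succ (4 * m + 2 * s + 4 + 1), Nat.factorial_succ (4 * m + 2 * s + 4),
      Nat.factorial_succ (3 * m + 1 + s), Nat.factorial_succ (2 * m + s + 2),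
      Nat.factorial_succ s] at h
    rw [Nat.factorial_succ t]
    push_cast at h hr ⊢
    have hne : ((3 * (m + s) + 5) * (m + s + 2) * (3 * m + 2 + s) * (2 * m + s + 3) * 2 : ℚ) ≠ 0 := by
      positivity
    apply mul_left_cancel₀ hne
    generalize (Nat.factorial s : ℚ) = f1 at *
    generalize (Nat.factorial t : ℚ) = f2 at *
    generalize (Nat.factorial (4 * m + 2) : ℚ) = f3 at *
    generalize (Nat.factorial (4 * m + 2 * s + 4) : ℚ) = f4 at *
    generalize (Nat.factorial (3 * m + 3) : ℚ) = f5 at *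
    generalize (Nat.factorial (m + 1) : ℚ) = f6 at *
    generalize (Nat.factorial (3 * m + 1 + s) : ℚ) = f7 at *
    generalize (Nat.factorial (6 * m + 6) : ℚ) = f8 at *
    generalize (Nat.factorial (2 * m + s + 2) : ℚ) = f9 at *
    generalize colSum m (m + s) = x at *
    generalize colSum m (m + s + 1) = y at *
    generalize (m : ℚ) = m at *
    generalize (s : ℚ) = s at *
    linear_combination (2 * (2 * m + s + 3) * (6 * m + 5) * (2 * m + 2) * f1 * f2 * f3 * f4 * f5) *
      hr + (2 * (3 * (m + s) + 2) * (m + s + 1)) * h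

lemma colSum_self {m : ℕ} (hm : 1 ≤ m) : colSum m m = colCoeff m m *
    (Nat.factorial (6 * m + 4) * Nat.factorial (2 * m + 2) /
      (Nat.factorial (4 * m + 4) * Nat.factorial (4 * m + 2))) := by
  have h := colSum_mul_factorials hm (m + 1) 0 (by ring)
  rw [show 4 * m + 2 * 0 + 4 = 4 * m + 4 by ring, show 3 * m + 1 + 0 = 3 * m + 1 by ring,
    show 2 * m + 0 + 2 = 2 * m + 2 by ring, show m + 0 = m by ring] at h
  rw [show 6 * m + 6 = (6 * m + 4) + 1 + 1 by ring, show 3 * m + 3 = (3 * m + 1) + 1 + 1 by ring] at h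
  simp only [Nat.factorial_succ (6 * m + 4 + 1), Nat.factorial_succ (6 * m + 4),
    Nat.factorial_succ (3 * m + 1 + 1), Nat.factorial_succ (3 * m + 1), Nat.factorial_zero] at h
  push_cast at h
  have h1 : (Nat.factorial (3 * m + 1) : ℚ) ≠ 0 := by positivity
  have h2 : (Nat.factorial (m + 1) : ℚ) ≠ 0 := by positivity
  have h3 : ((6 * m + 5) * (2 * m + 2) * (3 * m + 3) * (3 * m + 2) : ℚ) ≠ 0 := by positivity
  rw [mul_div_assoc', eq_div_iff (by positivity)]
  apply mul_left_cancel₀ (mul_ne_zero (mul_ne_zero h1 h2) h3)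
  linear_combination h

/-- The matrix of the Mills-Robbins-Rumsey determinant with parameter `1`. -/
def mrrMatrix (n : ℕ) : Matrix (Fin n) (Fin n) ℚ := Matrix.of fun i j => skewBinom i j

lemma det_mrrMatrix_succ (n : ℕ) : (mrrMatrix (n + 1)).det = (mrrMatrix n).det *
    (Nat.factorial (6 * n + 4) * Nat.factorial (2 * n + 2) /
      (Nat.factorial (4 * n + 4) * Nat.factorial (4 * n + 2))) := by
  rcases Nat.eq_zero_or_pos n with rfl | hn
  -- The vector `colCoeff 0` is zero, so that the case `n = 0` has to be treated separately.
  · simp [mrrMatrix, skewBinom, Nat.factorial]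
  have hc : colCoeff n n ≠ 0 := by
    have := colCoeffAux_ne_zero hn le_rfl
    unfold colCoeff
    positivity
  apply mul_left_cancel₀ hc
  have h := Matrix.det_updateCol_sum (mrrMatrix (n + 1)) (Fin.last n) (fun j => colCoeff n j)
  rw [smul_eq_mul, Fin.val_last] at h
  rw [← h, Matrix.det_succ_column _ (Fin.last n), Fin.sum_univ_castSucc, Finset.sum_eq_zero,
    zero_add]
  · have hs : (((mrrMatrix (n + 1)).updateCol (Fin.last n) fun k => ∑ i : Fin (n + 1),
        colCoeff n i • mrrMatrix (n + 1) k i).submatrix (Fin.last n).succAbove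
        (Fin.last n).succAbove) = mrrMatrix n := by
      ext i j
      simp [mrrMatrix, (Fin.castSucc_lt_last j).ne]
    rw [hs, Matrix.updateCol_self]
    have hS : ∑ i : Fin (n + 1), colCoeff n i • mrrMatrix (n + 1) (Fin.last n) i = colSum n n := by
      simp only [mrrMatrix, Matrix.of_apply, colSum, Finset.sum_range, smul_eq_mul, Fin.val_last,
        mul_comm]
    rw [hS, colSum_self hn, Fin.val_last, Even.neg_one_pow ⟨n, rfl⟩]
    ring
  · intro i _
    have hS : ∑ j : Fin (n + 1), colCoeff n j • mrrMatrix (n + 1) i.castSucc j = colSum n i := by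
      simp only [mrrMatrix, Matrix.of_apply, colSum, Finset.sum_range, smul_eq_mul,
        Fin.val_castSucc, mul_comm]
    rw [Matrix.updateCol_self, hS, colSum_eq_zero i.2, mul_zero, zero_mul]

/-- The Mills-Robbins-Rumsey determinant evaluation for the parameter `1`. -/
theorem det_mrrMatrix (n : ℕ) : (mrrMatrix n).det = ∏ k ∈ Finset.Icc 1 n,
    (Nat.factorial (6 * k - 2) : ℚ) / (Nat.factorial (2 * k + 2 * n) : ℚ) := by
  induction n with
  | zero => simp
  | succ n ih =>
    -- Passing from `n` to `n + 1` shifts the index in the product of the denominators.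
    have key : ∀ N : ℕ, (∏ k ∈ Finset.Icc 1 N, (Nat.factorial (2 * k + 2 * (n + 1)) : ℚ)) *
        Nat.factorial (2 * n + 2) = (∏ k ∈ Finset.Icc 1 N, (Nat.factorial (2 * k + 2 * n) : ℚ)) *
        Nat.factorial (2 * N + 2 * n + 2) := by
      intro N
      induction N with
      | zero => simp
      | succ N ihN =>
        rw [Finset.prod_Icc_succ_top (by omega), Finset.prod_Icc_succ_top (by omega),
          mul_right_comm, ihN, show 2 * (N + 1) + 2 * (n + 1) = 2 * (N + 1) + 2 * n + 2 by ring,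
          show 2 * (N + 1) + 2 * n = 2 * N + 2 * n + 2 by ring]
    have hk := key n
    rw [det_mrrMatrix_succ, ih, Finset.prod_Icc_succ_top (by omega), Finset.prod_div_distrib,
      Finset.prod_div_distrib, show 6 * (n + 1) - 2 = 6 * n + 4 by omega,
      show 2 * (n + 1) + 2 * (n + 1) = 4 * n + 4 by ring]
    rw [show 2 * n + 2 * n + 2 = 4 * n + 2 by ring] at hk
    have h1 : ∏ k ∈ Finset.Icc 1 n, (Nat.factorial (2 * k + 2 * (n + 1)) : ℚ) ≠ 0 :=
      Finset.prod_ne_zero_iff.2 fun _ _ => by positivity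
    have h2 : ∏ k ∈ Finset.Icc 1 n, (Nat.factorial (2 * k + 2 * n) : ℚ) ≠ 0 :=
      Finset.prod_ne_zero_iff.2 fun _ _ => by positivity
    have h3 : (Nat.factorial (4 * n + 4) : ℚ) ≠ 0 := by positivity
    have h4 : (Nat.factorial (4 * n + 2) : ℚ) ≠ 0 := by positivity
    field_simp
    linear_combination hk

/-! ### Sums of maximal minors -/

/-- The sign of the permutation sorting a sequence of natural numbers, and `0` if two of its
entries agree; encoded as the sign of the Vandermonde determinant of the sequence. -/
noncomputable def sortSign {N : ℕ} (φ : Fin N → ℕ) : ℤ :=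
  (SignType.sign (Matrix.vandermonde fun i => (φ i : ℤ)).det : SignType)

lemma sortSign_comp_perm {N : ℕ} (φ : Fin N → ℕ) (σ : Equiv.Perm (Fin N)) :
    sortSign (φ ∘ σ) = Equiv.Perm.sign σ * sortSign φ := by
  have h : (Matrix.vandermonde fun i => ((φ ∘ σ) i : ℤ)) =
      (Matrix.vandermonde fun i => (φ i : ℤ)).submatrix σ id := rfl
  unfold sortSign
  rw [h, Matrix.det_permute]
  rcases Int.units_eq_one_or (Equiv.Perm.sign σ) with h1 | h1 <;> rw [h1] <;> simp [Left.sign_neg]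

lemma sortSign_of_not_injective {N : ℕ} {φ : Fin N → ℕ} (h : ¬ Function.Injective φ) :
    sortSign φ = 0 := by
  have : (Matrix.vandermonde fun i => (φ i : ℤ)).det = 0 := by
    rw [Matrix.det_vandermonde_eq_zero_iff]
    simp only [Function.Injective, not_forall] at h
    obtain ⟨i, j, h1, h2⟩ := h
    exact ⟨i, j, by exact_mod_cast h1, h2⟩
  simp [sortSign, this]

lemma sortSign_eq_prod {N : ℕ} (φ : Fin N → ℕ) : sortSign φ =
    ((∏ i : Fin N, ∏ j ∈ Finset.Ioi i, SignType.sign ((φ j : ℤ) - φ i) : SignType) : ℤ) := by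
  unfold sortSign
  rw [Matrix.det_vandermonde]
  congr 1
  change signHom _ = _
  simp [map_prod, signHom]

/-- The sign depends on the relative order of the entries only. -/
lemma sortSign_congr {N : ℕ} {φ ψ : Fin N → ℕ}
    (h : ∀ i j, i ≠ j → (φ i < φ j ↔ ψ i < ψ j)) : sortSign φ = sortSign ψ := by
  rw [sortSign_eq_prod, sortSign_eq_prod]
  congr 1
  refine Finset.prod_congr rfl fun i _ => Finset.prod_congr rfl fun j hj => ?_
  have hij : i ≠ j := (Finset.mem_Ioi.1 hj).ne
  have h1 := h i j hij
  have h2 := h j i hij.symm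
  rcases lt_trichotomy (φ i) (φ j) with h3 | h3 | h3
  · rw [sign_pos (by omega), sign_pos (by omega)]
  · rw [h3, sub_self, show ψ j = ψ i by omega, sub_self]
  · rw [sign_neg (by omega), sign_neg (by omega)]

lemma sortSign_of_strictMono {N : ℕ} {φ : Fin N → ℕ} (h : StrictMono φ) : sortSign φ = 1 := by
  rw [sortSign_eq_prod, Finset.prod_eq_one, SignType.coe_one]
  intro i _
  refine Finset.prod_eq_one fun j hj => sign_pos ?_
  have := h (Finset.mem_Ioi.1 hj)
  omega

/-- The sum of the maximal minors of a matrix, as a sum over all choices of a column for each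
row. -/
lemma sum_det_submatrix_strictMono {N K : ℕ} (M : Matrix (Fin N) (Fin K) ℤ) :
    ∑ p : Fin N → Fin K with StrictMono p, (M.submatrix id p).det =
      ∑ φ : Fin N → Fin K, sortSign (fun i => (φ i : ℕ)) * ∏ i, M i (φ i) := by
  have h1 : ∀ p : Fin N → Fin K, (M.submatrix id p).det =
      ∑ σ : Equiv.Perm (Fin N), (Equiv.Perm.sign σ : ℤ) * ∏ i, M i (p (σ i)) := by
    intro p
    rw [← Matrix.det_transpose, Matrix.det_apply']
    rfl
  simp_rw [h1]
  rw [← Finset.sum_product',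
    ← Finset.sum_filter_of_ne (p := fun φ : Fin N → Fin K => Function.Injective φ)]
  swap
  · intro φ _ hne
    by_contra hinj
    apply hne
    rw [sortSign_of_not_injective, zero_mul]
    exact fun h => hinj fun a b hab => h (by simp [hab])
  refine Finset.sum_bij' (fun x _ => x.1 ∘ x.2)
    (fun φ _ => (φ ∘ Tuple.sort φ, (Tuple.sort φ)⁻¹)) ?_ ?_ ?_ ?_ ?_
  · rintro ⟨p, σ⟩ h
    simp only [Finset.mem_product, Finset.mem_filter, Finset.mem_univ, true_and, and_true] at h ⊢
    exact h.injective.comp σ.injective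
  · intro φ h
    simp only [Finset.mem_product, Finset.mem_filter, Finset.mem_univ, true_and, and_true] at h ⊢
    exact (Tuple.monotone_sort φ).strictMono_of_injective (h.comp (Tuple.sort φ).injective)
  · rintro ⟨p, σ⟩ h
    simp only [Finset.mem_product, Finset.mem_filter, Finset.mem_univ, true_and, and_true] at h
    have h2 : p ∘ σ ∘ (σ⁻¹ : Equiv.Perm _) = p := by ext; simp
    have h3 : (p ∘ σ) ∘ Tuple.sort (p ∘ σ) = p := by
      rw [Tuple.comp_perm_comp_sort_eq_comp_sort]
      have := (Tuple.comp_sort_eq_comp_iff_monotone (f := p) (σ := 1)).2 h.monotone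
      rw [← this]; rfl
    have h4 : σ * Tuple.sort (p ∘ σ) = 1 := by
      ext1 i
      exact h.injective (congrFun h3 i)
    simp only [h3, Prod.mk.injEq, true_and]
    exact (eq_inv_of_mul_eq_one_left h4).symm
  · intro φ _
    ext i
    simp
  · rintro ⟨p, σ⟩ h
    simp only [Finset.mem_product, Finset.mem_filter, Finset.mem_univ, true_and, and_true] at h
    have h2 : sortSign (fun i => ((p ∘ σ) i : ℕ)) = Equiv.Perm.sign σ := by
      have := sortSign_comp_perm (fun i => (p i : ℕ)) σ
      rw [sortSign_of_strictMono (φ := fun i => (p i : ℕ)) (fun a b hab => h hab), mul_one] at this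
      exact this
    rw [h2]
    rfl

/-- The total sign of the sequences which have an entry `2 * μ b + 1` for `b : B`, and for `a : A`
either the entry `2 * κ a` or, with the opposite sign, the entry `2 * κ a + 1`. -/
noncomputable def pairSign {A B : Type*} [Fintype A] [DecidableEq A] {N : ℕ}
    (e : A ⊕ B ≃ Fin N) (κ : A → ℕ) (μ : B → ℕ) : ℤ :=
  ∑ ε : A → Fin 2, (∏ a, (-1) ^ (ε a : ℕ)) *
    sortSign (Sum.elim (fun a => 2 * κ a + ε a) (fun b => 2 * μ b + 1) ∘ e.symm)

lemma pairSign_of_not_injective_right {A B : Type*} [Fintype A] [DecidableEq A] {N : ℕ}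
    (e : A ⊕ B ≃ Fin N) (κ : A → ℕ) {μ : B → ℕ}
    (h : ¬ Function.Injective μ) : pairSign e κ μ = 0 := by
  refine Finset.sum_eq_zero fun ε _ => ?_
  rw [sortSign_of_not_injective, mul_zero]
  intro h1
  refine h fun b b' hb => ?_
  have := (h1.of_comp_right e.symm.surjective) (a₁ := Sum.inr b) (a₂ := Sum.inr b') (by simp [hb])
  simpa using this

lemma sortSign_comp_sumCongr {A B : Type*} [Fintype A] [Fintype B]
    [DecidableEq A] [DecidableEq B] {N : ℕ} (e : A ⊕ B ≃ Fin N) (φ : A ⊕ B → ℕ) (σ : Equiv.Perm A)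
    (τ : Equiv.Perm B) : sortSign ((φ ∘ Equiv.sumCongr σ τ) ∘ e.symm) =
      Equiv.Perm.sign σ * Equiv.Perm.sign τ * sortSign (φ ∘ e.symm) := by
  have h : (φ ∘ Equiv.sumCongr σ τ) ∘ e.symm =
      (φ ∘ e.symm) ∘ (e.permCongr (Equiv.Perm.sumCongr σ τ)) := by
    ext i; simp [Equiv.permCongr_apply]
  rw [h, sortSign_comp_perm, Equiv.Perm.sign_permCongr, Equiv.Perm.sign_sumCongr]
  push_cast
  rfl

/-- If two entries of `κ` agree, exchanging their two positions is a sign-reversing symmetry. -/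
lemma pairSign_of_not_injective_left {A B : Type*} [Fintype A] [Fintype B]
    [DecidableEq A] [DecidableEq B] {N : ℕ} (e : A ⊕ B ≃ Fin N) {κ : A → ℕ} (μ : B → ℕ)
    (h : ¬ Function.Injective κ) : pairSign e κ μ = 0 := by
  simp only [Function.Injective, not_forall] at h
  obtain ⟨a, a', h1, h2⟩ := h
  have hκ : ∀ x, κ (Equiv.swap a a' x) = κ x := by
    intro x
    by_cases hx : x = a
    · rw [hx, Equiv.swap_apply_left, h1]
    by_cases hx' : x = a'
    · rw [hx', Equiv.swap_apply_right, h1]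
    rw [Equiv.swap_apply_of_ne_of_ne hx hx']
  have key : pairSign e κ μ = - pairSign e κ μ := by
    conv_lhs => unfold pairSign
    rw [← Equiv.sum_comp ((Equiv.swap a a').arrowCongr (Equiv.refl (Fin 2)))]
    unfold pairSign
    rw [← Finset.sum_neg_distrib]
    refine Finset.sum_congr rfl fun ε _ => ?_
    have h3 : Sum.elim (fun x => 2 * κ x +
        (((Equiv.swap a a').arrowCongr (Equiv.refl (Fin 2)) ε x : Fin 2) : ℕ))
        (fun b => 2 * μ b + 1) = Sum.elim (fun x => 2 * κ x + (ε x : ℕ)) (fun b => 2 * μ b + 1) ∘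
          Equiv.sumCongr (Equiv.swap a a') (1 : Equiv.Perm B) := by
      ext x
      rcases x with x | x
      · change 2 * κ x + (ε (Equiv.swap a a' x) : ℕ) =
          2 * κ (Equiv.swap a a' x) + (ε (Equiv.swap a a' x) : ℕ)
        rw [hκ]
      · rfl
    rw [h3, sortSign_comp_sumCongr, Equiv.Perm.sign_swap h2]
    have h4 : ∏ x, (-1 : ℤ) ^ (((Equiv.swap a a').arrowCongr (Equiv.refl (Fin 2)) ε x : Fin 2) : ℕ)
        = ∏ x, (-1 : ℤ) ^ (ε x : ℕ) := by
      rw [← Equiv.prod_comp (Equiv.swap a a')]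
      simp
    rw [h4]
    simp
  omega

/-- An entry of `κ` which is not matched by an entry of `μ` makes the sum cancel. -/
lemma pairSign_of_notMem {A B : Type*} [Fintype A] [DecidableEq A] {N : ℕ} (e : A ⊕ B ≃ Fin N) {κ : A → ℕ} {μ : B → ℕ}
    (hκ : Function.Injective κ) {a : A} (ha : ∀ b, μ b ≠ κ a) : pairSign e κ μ = 0 := by
  -- Exchanging the entries `2 * κ a` and `2 * κ a + 1` moves no entry past another one.
  let flip : Equiv.Perm (A → Fin 2) := Function.Involutive.toPerm
    (fun ε => Function.update ε a (1 - ε a)) (by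
      intro ε
      ext x
      by_cases hx : x = a
      · subst hx; simp
      · simp [hx])
  have hflip : ∀ ε x, flip ε x = if x = a then 1 - ε a else ε x := by
    intro ε x
    change Function.update ε a (1 - ε a) x = _
    rw [Function.update_apply]
  have key : pairSign e κ μ = - pairSign e κ μ := by
    conv_lhs => unfold pairSign
    rw [← Equiv.sum_comp flip]
    unfold pairSign
    rw [← Finset.sum_neg_distrib]
    refine Finset.sum_congr rfl fun ε _ => ?_
    have h1 : ∏ x, (-1 : ℤ) ^ (flip ε x : ℕ) = - ∏ x, (-1 : ℤ) ^ (ε x : ℕ) := by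
      rw [← Finset.mul_prod_erase _ _ (Finset.mem_univ a),
        ← Finset.mul_prod_erase _ (fun x => (-1 : ℤ) ^ (ε x : ℕ)) (Finset.mem_univ a), ← neg_mul]
      congr 1
      · rw [hflip, if_pos rfl]
        generalize ε a = z
        fin_cases z <;> simp
      · refine Finset.prod_congr rfl fun x hx => ?_
        rw [hflip, if_neg (Finset.ne_of_mem_erase hx)]
    rw [h1, neg_mul]
    congr 2
    refine sortSign_congr fun i j hij => ?_
    have hij' : e.symm i ≠ e.symm j := fun h => hij (e.symm.injective h)
    simp only [Function.comp_apply]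
    have b1 : ∀ (ε : A → Fin 2) x, (ε x : ℕ) < 2 := fun ε x => (ε x).2
    rcases hi : e.symm i with x | x <;> rcases hj : e.symm j with y | y <;>
      simp only [Sum.elim_inl, Sum.elim_inr]
    · have hxy : x ≠ y := fun h => hij' (by rw [hi, hj, h])
      have := hκ.ne hxy
      have := b1 ε x; have := b1 ε y; have := b1 (flip ε) x; have := b1 (flip ε) y
      omega
    · rcases eq_or_ne x a with rfl | hx
      · have := ha y
        have := b1 ε x; have := b1 (flip ε) x
        omega
      · rw [hflip, if_neg hx]
    · rcases eq_or_ne y a with rfl | hy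
      · have := ha x
        have := b1 ε y; have := b1 (flip ε) y
        omega
      · rw [hflip, if_neg hy]
  omega

lemma pairSign_eq_zero_of_card_lt {A B : Type*} [Fintype A] [Fintype B] [DecidableEq A]
    [DecidableEq B] {N : ℕ} (e : A ⊕ B ≃ Fin N) (h : Fintype.card B < Fintype.card A)
    (κ : A → ℕ) (μ : B → ℕ) : pairSign e κ μ = 0 := by
  by_cases hκ : Function.Injective κ
  swap
  · exact pairSign_of_not_injective_left e μ hκ
  by_cases ha : ∃ a, ∀ b, μ b ≠ κ a
  · obtain ⟨a, ha⟩ := ha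
    exact pairSign_of_notMem e hκ ha
  · push Not at ha
    choose f hf using ha
    have := Fintype.card_le_of_injective f fun a a' haa => hκ (by rw [← hf, ← hf, haa])
    omega

/-- The matching of `κ` with `μ`, counted with its sign. The hypothesis on `e` fixes the order of the
rows: the rows of the two kinds alternate. -/
lemma pairSign_eq_det {N n : ℕ} (e : Fin n ⊕ Fin n ≃ Fin N)
    (he : ∀ μ : Fin n → ℕ, StrictMono μ →
      StrictMono (Sum.elim (fun a => 2 * μ a) (fun b => 2 * μ b + 1) ∘ e.symm))
    (κ μ : Fin n → ℕ) :
    pairSign e κ μ = (Matrix.of fun i j => if κ i = μ j then (1 : ℤ) else 0).det := by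
  by_cases hμ : Function.Injective μ
  swap
  · rw [pairSign_of_not_injective_right e κ hμ]
    simp only [Function.Injective, not_forall] at hμ
    obtain ⟨a, a', h1, h2⟩ := hμ
    exact (Matrix.det_zero_of_column_eq h2 fun i => by simp [h1]).symm
  by_cases hκ : Function.Injective κ
  swap
  · rw [pairSign_of_not_injective_left e μ hκ]
    simp only [Function.Injective, not_forall] at hκ
    obtain ⟨a, a', h1, h2⟩ := hκ
    exact (Matrix.det_zero_of_row_eq h2 (by ext j; simp [h1])).symm
  by_cases ha : ∃ a, ∀ b, μ b ≠ κ a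
  · obtain ⟨a, ha⟩ := ha
    rw [pairSign_of_notMem e hκ ha]
    exact (Matrix.det_eq_zero_of_row_eq_zero a fun j => by simp [(ha j).symm]).symm
  push Not at ha
  choose f hf using ha
  have hfi : Function.Injective f := fun a a' haa => hκ (by rw [← hf, ← hf, haa])
  let σ : Equiv.Perm (Fin n) := Equiv.ofBijective f (Finite.injective_iff_bijective.1 hfi)
  have hσ : ∀ a, κ a = μ (σ a) := fun a => (hf a).symm
  have hdet : (Matrix.of fun i j => if κ i = μ j then (1 : ℤ) else 0) =
      (1 : Matrix (Fin n) (Fin n) ℤ).submatrix σ id := by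
    ext i j
    simp [hσ, hμ.eq_iff, Matrix.one_apply]
  rw [hdet, Matrix.det_permute, Matrix.det_one, mul_one]
  unfold pairSign
  rw [Finset.sum_eq_single 0]
  -- As `2 * κ a + 1 = 2 * μ (σ a) + 1`, only the choice `ε = 0` gives distinct entries.
  · have h1 : (Sum.elim (fun a => 2 * κ a + ((0 : Fin n → Fin 2) a : ℕ)) fun b => 2 * μ b + 1) =
        (Sum.elim (fun a => 2 * μ a) fun b => 2 * μ b + 1) ∘
          Equiv.sumCongr σ (1 : Equiv.Perm (Fin n)) := by
      ext x; rcases x with x | x <;> simp [hσ]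
    have h2 : (Sum.elim (fun a => 2 * (μ ∘ Tuple.sort μ) a) fun b => 2 * (μ ∘ Tuple.sort μ) b + 1) =
        (Sum.elim (fun a => 2 * μ a) fun b => 2 * μ b + 1) ∘
          Equiv.sumCongr (Tuple.sort μ) (Tuple.sort μ) := by
      ext x; rcases x with x | x <;> simp
    have h3 := sortSign_of_strictMono (he _ ((Tuple.monotone_sort μ).strictMono_of_injective
      (hμ.comp (Tuple.sort μ).injective)))
    rw [h2, sortSign_comp_sumCongr, ← Units.val_mul, Int.units_mul_self, Units.val_one,
      one_mul] at h3
    rw [h1, sortSign_comp_sumCongr, h3]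
    simp
  · intro ε _ hε
    obtain ⟨a, ha⟩ := Function.ne_iff.1 hε
    have h1 : (ε a : ℕ) = 1 := by
      have := (ε a).2
      have : (ε a : ℕ) ≠ 0 := fun h => ha (Fin.ext h)
      omega
    rw [sortSign_of_not_injective, mul_zero]
    intro hinj
    have := (hinj.of_comp_right e.symm.surjective) (a₁ := Sum.inl a) (a₂ := Sum.inr (σ a))
      (by simp [hσ, h1])
    simp at this
  · simp

/-- The sum of the maximal minors of a matrix with `2 * K` columns, if the rows of type `A` have
opposite entries in the columns `2 * k` and `2 * k + 1`, and the rows of type `B` vanish in the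
columns `2 * k`. -/
lemma sum_det_eq_sum_pairSign {A B : Type*} [Fintype A] [Fintype B] [DecidableEq A]
    [DecidableEq B] {N : ℕ} (e : A ⊕ B ≃ Fin N) (K : ℕ) (M : Fin N → ℕ → ℤ)
    (hA : ∀ a k, M (e (Sum.inl a)) (2 * k + 1) = - M (e (Sum.inl a)) (2 * k))
    (hB : ∀ b k, M (e (Sum.inr b)) (2 * k) = 0) :
    ∑ p : Fin N → Fin (K * 2) with StrictMono p, (Matrix.of fun i j => M i (p j)).det =
      ∑ κ : A → Fin K, ∑ μ : B → Fin K, (∏ a, M (e (Sum.inl a)) (2 * κ a)) *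
        (∏ b, M (e (Sum.inr b)) (2 * μ b + 1)) *
        pairSign e (fun a => (κ a : ℕ)) (fun b => (μ b : ℕ)) := by
  have h0 := sum_det_submatrix_strictMono
    (Matrix.of fun (i : Fin N) (k : Fin (K * 2)) => M i (k : ℕ))
  have h1 : ∀ p : Fin N → Fin (K * 2), (Matrix.of fun i j => M i (p j)) =
      (Matrix.of fun (i : Fin N) (k : Fin (K * 2)) => M i (k : ℕ)).submatrix id p :=
    fun p => rfl
  simp_rw [h1]
  rw [h0]
  let E : ((A → Fin K) × (A → Fin 2)) × ((B → Fin K) × (B → Fin 2)) ≃ (Fin N → Fin (K * 2)) :=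
    ((Equiv.arrowProdEquivProdArrow A (fun _ => Fin K) (fun _ => Fin 2)).symm.prodCongr
      (Equiv.arrowProdEquivProdArrow B (fun _ => Fin K) (fun _ => Fin 2)).symm).trans
      ((Equiv.sumArrowEquivProdArrow A B (Fin K × Fin 2)).symm.trans
        (e.arrowCongr finProdFinEquiv))
  have hE : ∀ κ ε μ δ i, (E ((κ, ε), (μ, δ)) i : ℕ) =
      Sum.elim (fun a => 2 * (κ a : ℕ) + ε a) (fun b => 2 * (μ b : ℕ) + δ b) (e.symm i) := by
    intro κ ε μ δ i
    rcases h : e.symm i with a | b <;>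
      simp [E, Equiv.arrowCongr, h, Equiv.sumArrowEquivProdArrow, Equiv.arrowProdEquivProdArrow,
        finProdFinEquiv, add_comm]
  rw [← Equiv.sum_comp E, Fintype.sum_prod_type, Fintype.sum_prod_type]
  refine Finset.sum_congr rfl fun κ _ => ?_
  simp_rw [Fintype.sum_prod_type]
  rw [Finset.sum_comm]
  refine Finset.sum_congr rfl fun μ _ => ?_
  unfold pairSign
  rw [Finset.mul_sum]
  refine Finset.sum_congr rfl fun ε _ => ?_
  have hprod : ∀ δ : B → Fin 2, ∏ i, (Matrix.of fun (i : Fin N) (k : Fin (K * 2)) =>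
      M i (k : ℕ)) i (E ((κ, ε), (μ, δ)) i) =
      (∏ a, M (e (Sum.inl a)) (2 * κ a + ε a)) *
        ∏ b, M (e (Sum.inr b)) (2 * μ b + δ b) := by
    intro δ
    rw [← Equiv.prod_comp e, Fintype.prod_sum_type]
    simp [hE]
  simp_rw [hprod]
  rw [Finset.sum_eq_single (fun _ => 1)]
  · have hs : (fun i => (E ((κ, ε), (μ, fun _ => 1)) i : ℕ)) =
        Sum.elim (fun a => 2 * (κ a : ℕ) + ε a) (fun b => 2 * (μ b : ℕ) + 1) ∘ e.symm := by
      funext i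
      rw [hE]
      rfl
    have hg : ∏ a, M (e (Sum.inl a)) (2 * κ a + ε a) =
        (∏ a, M (e (Sum.inl a)) (2 * κ a)) * ∏ a, (-1) ^ (ε a : ℕ) := by
      rw [← Finset.prod_mul_distrib]
      refine Finset.prod_congr rfl fun a _ => ?_
      generalize ε a = z
      fin_cases z
      · simp
      · simp [hA]
    rw [hs, hg]
    simp only [Fin.val_one]
    ring
  · intro δ _ hδ
    obtain ⟨b, hb⟩ := Function.ne_iff.1 hδ
    have hb0 : δ b = 0 := by
      generalize δ b = z at hb
      fin_cases z
      · rfl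
      · simp at hb
    rw [Finset.prod_eq_zero (i := b) (Finset.mem_univ b) (by simp [hb0, hB])]
    simp
  · simp

/-- Expansion of the determinant of a product of rectangular matrices along the rows. -/
lemma det_sum_mul_left {n : ℕ} {ι : Type*} [Fintype ι] (O : Fin n → ι → ℤ)
    (X : ι → Fin n → ℤ) :
    (Matrix.of fun i j => ∑ k, O i k * X k j).det =
      ∑ κ : Fin n → ι, (∏ i, O i (κ i)) * (Matrix.of fun i j => X (κ i) j).det := by
  have h := (Matrix.detRowAlternating (n := Fin n) (R := ℤ)).toMultilinearMap.map_sum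
    (fun i (k : ι) => O i k • X k)
  have h1 : (Matrix.of fun i j => ∑ k, O i k * X k j) = fun i => ∑ k, O i k • X k := by
    ext i j
    simp
  rw [h1]
  refine h.trans (Finset.sum_congr rfl fun κ _ => ?_)
  exact (Matrix.detRowAlternating (n := Fin n) (R := ℤ)).toMultilinearMap.map_smul_univ _ _

lemma sum_prod_mul_det_ite {n K : ℕ} (O E : Fin n → Fin K → ℤ) :
    ∑ κ : Fin n → Fin K, ∑ μ : Fin n → Fin K, (∏ i, O i (κ i)) * (∏ j, E j (μ j)) *
      (Matrix.of fun i j => if (κ i : ℕ) = μ j then (1 : ℤ) else 0).det =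
      (Matrix.of fun i j => ∑ k, O i k * E j k).det := by
  rw [det_sum_mul_left O (fun k j => E j k)]
  refine Finset.sum_congr rfl fun κ _ => ?_
  have h := det_sum_mul_left E (fun (k : Fin K) j => if (κ j : ℕ) = k then (1 : ℤ) else 0)
  have h1 : (Matrix.of fun i j => E j (κ i)) = (Matrix.of fun i j => ∑ k : Fin K,
      E i k * if (κ j : ℕ) = k then (1 : ℤ) else 0).transpose := by
    ext i j
    simp [← Fin.ext_iff]
  rw [h1, Matrix.det_transpose, h, Finset.mul_sum]
  refine Finset.sum_congr rfl fun μ _ => ?_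
  rw [← Matrix.det_transpose, mul_assoc]
  rfl

/-! ### Order ideals of a tetrahedron -/

/-- The triples `(r, b, d)` with `b + d ≤ r < n`. -/
def tetrahedron (n : ℕ) : Finset (ℕ × ℕ × ℕ) :=
  (Finset.range n ×ˢ Finset.range n ×ˢ Finset.range n).filter fun x => x.2.1 + x.2.2 ≤ x.1

lemma mem_tetrahedron {n r b d : ℕ} : (r, b, d) ∈ tetrahedron n ↔ b + d ≤ r ∧ r < n := by
  simp only [tetrahedron, Finset.mem_filter, Finset.mem_product, Finset.mem_range]
  omega

/-- The order ideals of the tetrahedron, for the order in which a triple decreases when `r` grows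
or when `b` and `b + d` decrease. -/
structure IsTetIdeal (n : ℕ) (I : Finset (ℕ × ℕ × ℕ)) : Prop where
  subset : I ⊆ tetrahedron n
  down : ∀ r b d r' b' d', (r, b, d) ∈ I → r ≤ r' → r' < n → b' ≤ b → b' + d' ≤ b + d →
    (r', b', d') ∈ I

open Classical in
/-- The finite set of all order ideals of the tetrahedron. -/
noncomputable def tetIdeals (n : ℕ) : Finset (Finset (ℕ × ℕ × ℕ)) :=
  (tetrahedron n).powerset.filter (IsTetIdeal n)

lemma mem_tetIdeals {n : ℕ} {I : Finset (ℕ × ℕ × ℕ)} : I ∈ tetIdeals n ↔ IsTetIdeal n I := by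
  simp only [tetIdeals, Finset.mem_filter, Finset.mem_powerset, and_iff_right_iff_imp]
  exact fun h => h.subset

lemma IsTetIdeal.bounds {n : ℕ} {I : Finset (ℕ × ℕ × ℕ)} (hI : IsTetIdeal n I) {r b d : ℕ}
    (h : (r, b, d) ∈ I) : b + d ≤ r ∧ r < n :=
  mem_tetrahedron.1 (hI.subset h)

/-- The position of the `r`-th path: `r` plus the number of triples `(r, b, 0)` of `I`. -/
def position (I : Finset (ℕ × ℕ × ℕ)) (r : ℕ) : ℕ :=
  ((Finset.range (r + 1)).filter fun b => (r, b, 0) ∈ I).card + r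

lemma position_le (I : Finset (ℕ × ℕ × ℕ)) (r : ℕ) : position I r ≤ 2 * r + 1 := by
  have := Finset.card_filter_le (Finset.range (r + 1)) fun b => (r, b, 0) ∈ I
  rw [Finset.card_range] at this
  unfold position
  omega

lemma position_eq {I : Finset (ℕ × ℕ × ℕ)} {r c : ℕ} (hc : c ≤ r + 1)
    (h : ∀ b, (r, b, 0) ∈ I ↔ b < c) : position I r = c + r := by
  have : ((Finset.range (r + 1)).filter fun b => (r, b, 0) ∈ I) = Finset.range c := by
    ext b
    simp only [Finset.mem_filter, Finset.mem_range, h]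
    omega
  rw [position, this, Finset.card_range]

/-- The entries of `I` in a row of the layer `d = 0` form an initial segment. -/
lemma IsTetIdeal.mem_iff {n : ℕ} {I : Finset (ℕ × ℕ × ℕ)} (hI : IsTetIdeal n I) (r b : ℕ) :
    (r, b, 0) ∈ I ↔ b + r < position I r := by
  have hex : ∃ c, (r, c, 0) ∉ I := ⟨r + 1, fun h => by have := hI.bounds h; omega⟩
  classical
  have hlt : ∀ b, (r, b, 0) ∈ I ↔ b < Nat.find hex := by
    intro b
    constructor
    · intro hb
      by_contra hle
      exact Nat.find_spec hex
        (hI.down r b 0 r _ 0 hb le_rfl (hI.bounds hb).2 (not_lt.1 hle) (by omega))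
    · intro hb
      exact not_not.1 (Nat.find_min hex hb)
  have hc : Nat.find hex ≤ r + 1 := Nat.find_min' hex fun h => by have := hI.bounds h; omega
  rw [position_eq hc hlt, hlt]
  omega

/-- The paths do not intersect. -/
lemma IsTetIdeal.position_lt {n : ℕ} {I : Finset (ℕ × ℕ × ℕ)} (hI : IsTetIdeal n I) {r r' : ℕ}
    (h : r < r') (h' : r' < n) : position I r < position I r' := by
  by_contra hle
  push Not at hle
  have h0 : r' ≤ position I r' := by unfold position; omega
  have h1 : (r, position I r' - r', 0) ∈ I := (hI.mem_iff _ _).2 (by omega)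
  have h2 := (hI.mem_iff _ _).1 (hI.down _ _ _ r' _ 0 h1 h.le h' le_rfl le_rfl)
  omega

/-- The layers `d ≥ 1` of `I`, as a subset of the next smaller tetrahedron. -/
def upperLayers (n : ℕ) (I : Finset (ℕ × ℕ × ℕ)) : Finset (ℕ × ℕ × ℕ) :=
  (tetrahedron n).filter fun x => (x.1 + 1, x.2.1, x.2.2 + 1) ∈ I

/-- The subset of the tetrahedron with upper layers `J` and a layer `d = 0` with positions `p`. -/
def addLayer (n : ℕ) (p : Fin (n + 1) → ℕ) (J : Finset (ℕ × ℕ × ℕ)) : Finset (ℕ × ℕ × ℕ) :=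
  (tetrahedron (n + 1)).filter fun x => (x.2.2 = 0 ∧ ∃ h : x.1 < n + 1, x.2.1 + x.1 < p ⟨x.1, h⟩) ∨
    (x.2.2 ≠ 0 ∧ (x.1 - 1, x.2.1, x.2.2 - 1) ∈ J)

/-- The positions which the upper layers `J` induce in the layer below, before its own steps. -/
def targets (n : ℕ) (J : Finset (ℕ × ℕ × ℕ)) : Fin (n + 1) → ℕ :=
  Fin.cons 1 fun r : Fin n => position J r + 2

lemma mem_upperLayers {n : ℕ} {I : Finset (ℕ × ℕ × ℕ)} (hI : IsTetIdeal (n + 1) I) {r b d : ℕ} :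
    (r, b, d) ∈ upperLayers n I ↔ (r + 1, b, d + 1) ∈ I := by
  simp only [upperLayers, Finset.mem_filter, mem_tetrahedron, and_iff_right_iff_imp]
  intro h
  have := hI.bounds h
  omega

lemma mem_addLayer_zero {n : ℕ} {p : Fin (n + 1) → ℕ} {J : Finset (ℕ × ℕ × ℕ)} {r b : ℕ} :
    (r, b, 0) ∈ addLayer n p J ↔ b ≤ r ∧ ∃ h : r < n + 1, b + r < p ⟨r, h⟩ := by
  simp only [addLayer, Finset.mem_filter, mem_tetrahedron]
  constructor
  · rintro ⟨h1, h2 | h2⟩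
    · exact ⟨h1.1, h2.2⟩
    · exact absurd rfl h2.1
  · rintro ⟨h1, h2, h3⟩
    exact ⟨⟨h1, h2⟩, Or.inl ⟨trivial, h2, h3⟩⟩

lemma mem_addLayer_succ {n : ℕ} {p : Fin (n + 1) → ℕ} {J : Finset (ℕ × ℕ × ℕ)}
    (hJ : IsTetIdeal n J) {r b d : ℕ} :
    (r, b, d + 1) ∈ addLayer n p J ↔ ∃ r', r = r' + 1 ∧ (r', b, d) ∈ J := by
  simp only [addLayer, Finset.mem_filter, mem_tetrahedron]
  constructor
  · rintro ⟨h1, h2 | h2⟩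
    · exact absurd h2.1 (by simp)
    · exact ⟨r - 1, by omega, by simpa using h2.2⟩
  · rintro ⟨r', rfl, h⟩
    have := hJ.bounds h
    refine ⟨⟨by omega, by omega⟩, Or.inr ⟨by simp, by simpa using h⟩⟩

lemma isTetIdeal_upperLayers {n : ℕ} {I : Finset (ℕ × ℕ × ℕ)} (hI : IsTetIdeal (n + 1) I) :
    IsTetIdeal n (upperLayers n I) where
  subset := Finset.filter_subset _ _
  down r b d r' b' d' h h1 h2 h3 h4 := by
    rw [mem_upperLayers hI] at h ⊢
    exact hI.down _ _ _ _ _ _ h (by omega) (by omega) h3 (by omega)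

/-- Each path makes at most one step between consecutive layers. -/
lemma position_upperLayers {n : ℕ} {I : Finset (ℕ × ℕ × ℕ)} (hI : IsTetIdeal (n + 1) I)
    (j : Fin (n + 1)) : targets n (upperLayers n I) j = position I j ∨
      targets n (upperLayers n I) j = position I j + 1 := by
  refine Fin.cases ?_ (fun r => ?_) j
  · have := position_le I 0
    simp only [targets, Fin.cons_zero, Fin.val_zero]
    omega
  · have hJ := isTetIdeal_upperLayers hI
    simp only [targets, Fin.cons_succ, Fin.val_succ]
    have h0 : (r : ℕ) + 1 ≤ position I (r + 1) := by unfold position; omega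
    have h0' : (r : ℕ) ≤ position (upperLayers n I) r := by unfold position; omega
    have h1 : position (upperLayers n I) r + 1 ≤ position I (r + 1) := by
      by_contra hlt
      have h2 := (hJ.mem_iff r (position (upperLayers n I) r - r - 1)).2 (by omega)
      rw [mem_upperLayers hI] at h2
      have h3 := (hI.mem_iff _ _).1 (hI.down _ _ _ (r + 1) _ 0 h2 le_rfl (by omega) le_rfl
        (by omega))
      omega
    have h2 : position I (r + 1) ≤ position (upperLayers n I) r + 2 := by
      by_contra hlt
      have h2 := (hI.mem_iff (r + 1) (position I (r + 1) - (r + 1) - 1)).2 (by omega)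
      have h3 := hI.down _ _ _ (r + 1) (position I (r + 1) - (r + 1) - 2) 1 h2 le_rfl (by omega)
        (by omega) (by omega)
      have h4 := (hJ.mem_iff _ _).1 ((mem_upperLayers hI).2 h3)
      omega
    omega

lemma isTetIdeal_addLayer {n : ℕ} {p : Fin (n + 1) → ℕ} (hp : StrictMono p)
    {J : Finset (ℕ × ℕ × ℕ)} (hJ : IsTetIdeal n J)
    (hc : ∀ j, targets n J j = p j ∨ targets n J j = p j + 1) :
    IsTetIdeal (n + 1) (addLayer n p J) where
  subset := Finset.filter_subset _ _
  down r b d r' b' d' h h1 h2 h3 h4 := by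
    have hc' : ∀ (r : ℕ) (hr : r + 1 < n + 1),
        position J r + 2 = p ⟨r + 1, hr⟩ ∨ position J r + 2 = p ⟨r + 1, hr⟩ + 1 := by
      intro r hr
      have := hc (Fin.succ ⟨r, by omega⟩)
      simp only [targets, Fin.cons_succ] at this
      exact this
    have hmono : ∀ r r' : ℕ, r ≤ r' → ∀ h : r < n + 1, ∀ h' : r' < n + 1,
        p ⟨r, h⟩ + r' ≤ p ⟨r', h'⟩ + r := by
      intro r r' hr
      induction r', hr using Nat.le_induction with
      | base => intros; exact le_rfl
      | succ k hk ih =>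
        intro h h'
        have h3 := ih h (by omega)
        have h4 : p ⟨k, by omega⟩ < p ⟨k + 1, h'⟩ := hp (by simp)
        omega
    rcases d with _ | d
    · obtain ⟨hb, hr, hlt⟩ := mem_addLayer_zero.1 h
      have hm := hmono r r' h1 hr h2
      rcases d' with _ | d'
      · exact mem_addLayer_zero.2 ⟨by omega, h2, by omega⟩
      · obtain ⟨k, rfl⟩ : ∃ k, r' = k + 1 := ⟨r' - 1, by omega⟩
        have := hc' k h2
        refine (mem_addLayer_succ hJ).2 ⟨k, rfl, ?_⟩
        exact hJ.down k (b - 1) 0 k b' d' ((hJ.mem_iff _ _).2 (by omega)) le_rfl (by omega)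
          (by omega) (by omega)
    · obtain ⟨k, rfl, hk⟩ := (mem_addLayer_succ hJ).1 h
      obtain ⟨k', rfl⟩ : ∃ k, r' = k + 1 := ⟨r' - 1, by omega⟩
      rcases d' with _ | d'
      · have := hc' k' h2
        have hk' := hJ.down _ _ _ k' b' 0 hk (by omega) (by omega) h3 (by omega)
        have hlt := (hJ.mem_iff _ _).1 hk'
        have hb := hJ.bounds hk'
        exact mem_addLayer_zero.2 ⟨by omega, h2, by omega⟩
      · exact (mem_addLayer_succ hJ).2 ⟨k', rfl,
          hJ.down _ _ _ k' b' d' hk (by omega) (by omega) h3 (by omega)⟩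

lemma position_addLayer {n : ℕ} {p : Fin (n + 1) → ℕ} (hp : StrictMono p)
    {J : Finset (ℕ × ℕ × ℕ)}
    (hc : ∀ j, targets n J j = p j ∨ targets n J j = p j + 1) (r : Fin (n + 1)) :
    position (addLayer n p J) r = p r := by
  have h1 : (r : ℕ) ≤ p r := by
    have : ∀ (r : ℕ) (h : r < n + 1), r ≤ p ⟨r, h⟩ := by
      intro r
      induction r with
      | zero => intros; omega
      | succ k ih =>
        intro h
        have h3 := ih (by omega)
        have h4 : p ⟨k, by omega⟩ < p ⟨k + 1, h⟩ := hp (by simp)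
        omega
    exact this r r.2
  have h2 : p r ≤ 2 * r + 1 := by
    have h3 := hc r
    have h4 : targets n J r ≤ 2 * r + 1 := by
      refine Fin.cases ?_ (fun k => ?_) r
      · simp [targets]
      · have := position_le J k
        simp only [targets, Fin.cons_succ, Fin.val_succ]
        omega
    omega
  rw [position_eq (c := p r - r) (by omega)]
  · omega
  · intro b
    rw [mem_addLayer_zero]
    constructor
    · rintro ⟨_, _, h⟩
      simp only [Fin.eta] at h
      omega
    · intro h
      exact ⟨by omega, r.2, by simp only [Fin.eta]; omega⟩

lemma upperLayers_addLayer {n : ℕ} (p : Fin (n + 1) → ℕ)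
    {J : Finset (ℕ × ℕ × ℕ)} (hJ : IsTetIdeal n J) : upperLayers n (addLayer n p J) = J := by
  ext ⟨r, b, d⟩
  simp only [upperLayers, Finset.mem_filter, mem_addLayer_succ hJ, mem_tetrahedron]
  constructor
  · rintro ⟨-, r', h, h'⟩
    obtain rfl : r = r' := by omega
    exact h'
  · intro h
    exact ⟨hJ.bounds h, r, rfl, h⟩

lemma addLayer_upperLayers {n : ℕ} {p : Fin (n + 1) → ℕ} {I : Finset (ℕ × ℕ × ℕ)}
    (hI : IsTetIdeal (n + 1) I) (hp : ∀ r : Fin (n + 1), position I r = p r) :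
    addLayer n p (upperLayers n I) = I := by
  ext ⟨r, b, d⟩
  rcases d with _ | d
  · rw [mem_addLayer_zero]
    constructor
    · rintro ⟨-, h2, h3⟩
      exact (hI.mem_iff _ _).2 (by rw [hp ⟨r, h2⟩]; exact h3)
    · intro h
      have := hI.bounds h
      exact ⟨by omega, this.2, by rw [← hp ⟨r, this.2⟩]; exact (hI.mem_iff _ _).1 h⟩
  · rw [mem_addLayer_succ (isTetIdeal_upperLayers hI)]
    constructor
    · rintro ⟨k, rfl, hk⟩
      exact (mem_upperLayers hI).1 hk
    · intro h
      have := hI.bounds h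
      obtain ⟨k, rfl⟩ : ∃ k, r = k + 1 := ⟨r - 1, by omega⟩
      exact ⟨k, rfl, (mem_upperLayers hI).2 h⟩

lemma neg_one_pow_card_eq {n : ℕ} {I : Finset (ℕ × ℕ × ℕ)} (hI : IsTetIdeal (n + 1) I) :
    (-1 : ℤ) ^ I.card = (-1) ^ (∑ r : Fin (n + 1), (position I r + r)) *
      (-1) ^ (upperLayers n I).card := by
  classical
  have h1 := Finset.card_filter_add_card_filter_not (s := I) (fun x => x.2.2 = 0)
  have h2 : (I.filter fun x => ¬ x.2.2 = 0).card = (upperLayers n I).card := by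
    refine Finset.card_bij' (fun x _ => (x.1 - 1, x.2.1, x.2.2 - 1))
      (fun x _ => (x.1 + 1, x.2.1, x.2.2 + 1)) ?_ ?_ ?_ ?_
    · rintro ⟨r, b, d⟩ h
      rw [Finset.mem_filter] at h
      have := hI.bounds h.1
      have hd : d ≠ 0 := h.2
      rw [mem_upperLayers hI]
      rw [show r - 1 + 1 = r by omega, show d - 1 + 1 = d by omega]
      exact h.1
    · rintro ⟨r, b, d⟩ h
      rw [Finset.mem_filter]
      exact ⟨(mem_upperLayers hI).1 h, by simp⟩
    · rintro ⟨r, b, d⟩ h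
      rw [Finset.mem_filter] at h
      have := hI.bounds h.1
      have hd : d ≠ 0 := h.2
      change (r - 1 + 1, b, d - 1 + 1) = (r, b, d)
      rw [show r - 1 + 1 = r by omega, show d - 1 + 1 = d by omega]
    · rintro ⟨r, b, d⟩ h
      simp
  have h3 : (I.filter fun x => x.2.2 = 0).card =
      ∑ r : Fin (n + 1), ((Finset.range ((r : ℕ) + 1)).filter fun b => ((r : ℕ), b, 0) ∈ I).card := by
    rw [← Finset.card_sigma]
    refine Finset.card_bij' (fun x hx => ⟨⟨x.1, ?_⟩, x.2.1⟩) (fun x _ => (x.1, x.2, 0))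
      ?_ ?_ ?_ ?_
    · rw [Finset.mem_filter] at hx
      exact (hI.bounds (r := x.1) (b := x.2.1) (d := x.2.2) hx.1).2
    · rintro ⟨r, b, d⟩ h
      rw [Finset.mem_filter] at h
      have := hI.bounds h.1
      obtain ⟨h, rfl⟩ : _ ∧ d = 0 := h
      simp only [Finset.mem_sigma, Finset.mem_univ, Finset.mem_filter, Finset.mem_range, true_and]
      exact ⟨by omega, h⟩
    · rintro ⟨r, b⟩ h
      simp only [Finset.mem_sigma, Finset.mem_univ, Finset.mem_filter, Finset.mem_range,
        true_and] at h
      simpa using h.2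
    · rintro ⟨r, b, d⟩ h
      rw [Finset.mem_filter] at h
      obtain ⟨h, rfl⟩ : _ ∧ d = 0 := h
      rfl
    · rintro ⟨r, b⟩ h
      rfl
  rw [← h1, h2, h3, pow_add]
  congr 1
  rw [Finset.sum_congr rfl fun (r : Fin (n + 1)) _ => show position I r + (r : ℕ) =
    ((Finset.range ((r : ℕ) + 1)).filter fun b => ((r : ℕ), b, 0) ∈ I).card + 2 * (r : ℕ) by
      unfold position; ring, Finset.sum_add_distrib, ← Finset.mul_sum, pow_add, pow_mul (-1) 2]
  simp

/-- Stripping off the layer `d = 0` of the ideals in which this layer has prescribed positions. -/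
lemma sum_tetIdeals_succ {n : ℕ} {p : Fin (n + 1) → ℕ} (hp : StrictMono p) :
    ∑ I ∈ tetIdeals (n + 1) with ∀ r : Fin (n + 1), position I r = p r, (-1 : ℤ) ^ I.card =
      ∑ J ∈ tetIdeals n with ∀ j, targets n J j = p j ∨ targets n J j = p j + 1,
        (-1) ^ (∑ r : Fin (n + 1), (p r + r)) * (-1 : ℤ) ^ J.card := by
  refine Finset.sum_bij' (fun I _ => upperLayers n I) (fun J _ => addLayer n p J) ?_ ?_ ?_ ?_ ?_
  · intro I h
    rw [Finset.mem_filter, mem_tetIdeals] at h ⊢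
    refine ⟨isTetIdeal_upperLayers h.1, fun j => ?_⟩
    rw [← h.2 j]
    exact position_upperLayers h.1 j
  · intro J h
    rw [Finset.mem_filter, mem_tetIdeals] at h ⊢
    exact ⟨isTetIdeal_addLayer hp h.1 h.2, position_addLayer hp h.2⟩
  · intro I h
    rw [Finset.mem_filter, mem_tetIdeals] at h
    exact addLayer_upperLayers h.1 h.2
  · intro J h
    rw [Finset.mem_filter, mem_tetIdeals] at h
    exact upperLayers_addLayer p h.1
  · intro I h
    rw [Finset.mem_filter, mem_tetIdeals] at h
    rw [neg_one_pow_card_eq h.1]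
    simp_rw [h.2]

/-! ### Nonintersecting paths -/

/-- The signed number of paths of index `r` which reach position `q - 1` before their last step. If
`f_r` is the polynomial with the coefficients `pathCoeff r p`, it is the coefficient of `X ^ q` in
`X` for `r = 0`, and in `(-1) ^ r * X ^ 2 * f_r (-X)` for index `r + 1`. The argument is shifted by
one so that a path which makes a step up, and comes from `p - 1`, has a natural number as argument
even for `p = 0`; the value is then `0`. -/
def preCoeff : ℕ → ℕ → ℤ
  | 0, q => if q = 1 then 1 else 0
  | _ + 1, 0 => 0
  | _ + 1, 1 => 0
  | r + 1, q + 2 => (-1) ^ (r + q) * (preCoeff r (q + 1) - preCoeff r q)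

/-- The signed number of paths of index `r` which end at position `p`: a path comes from position
`p`, or with a sign from position `p - 1`. -/
def pathCoeff (r p : ℕ) : ℤ := preCoeff r (p + 1) - preCoeff r p

lemma preCoeff_zero_right (r : ℕ) : preCoeff r 0 = 0 := by
  cases r <;> simp [preCoeff]

lemma preCoeff_succ_add_two (r q : ℕ) : preCoeff (r + 1) (q + 2) = (-1) ^ (r + q) * pathCoeff r q :=
  rfl

/-- Intersecting paths give equal columns, and a path of index `0` with a starting point different
from `0` gives a zero column or a zero row. -/
lemma det_preCoeff_eq_zero {n : ℕ} {q : Fin (n + 1) → ℕ} (hq : Monotone q)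
    (h : ¬ (StrictMono q ∧ q 0 = 1)) : (Matrix.of fun i j : Fin (n + 1) => preCoeff i (q j)).det = 0 := by
  by_cases hs : StrictMono q
  · have h0 : q 0 ≠ 1 := fun h0 => h ⟨hs, h0⟩
    rcases Nat.eq_zero_or_pos (q 0) with h1 | h1
    · exact Matrix.det_eq_zero_of_column_eq_zero 0 fun i => by simp [h1, preCoeff_zero_right]
    · refine Matrix.det_eq_zero_of_row_eq_zero 0 fun j => ?_
      have : q 0 ≤ q j := hq (Fin.zero_le j)
      simp only [Matrix.of_apply, Fin.val_zero, preCoeff]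
      rw [if_neg (by omega)]
  · have hi : ¬ Function.Injective q := fun hi => hs (hq.strictMono_of_injective hi)
    simp only [Function.Injective, not_forall] at hi
    obtain ⟨a, b, h1, h2⟩ := hi
    exact Matrix.det_zero_of_column_eq h2 fun i => by simp [h1]

/-- If the path of index `0` starts correctly, it can be removed together with the layer. -/
lemma det_preCoeff_succ {n : ℕ} {q : Fin (n + 1) → ℕ} (hq : StrictMono q) (h0 : q 0 = 1) :
    (Matrix.of fun i j : Fin (n + 1) => preCoeff i (q j)).det =
      (-1) ^ (∑ i : Fin n, ((i : ℕ) + q i.succ)) *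
        (Matrix.of fun i j : Fin n => pathCoeff i (q j.succ - 2)).det := by
  have h2 : ∀ j : Fin n, ∃ x, q j.succ = x + 2 := by
    intro j
    have := hq (Fin.succ_pos j)
    exact ⟨q j.succ - 2, by omega⟩
  rw [Matrix.det_succ_row_zero, Fin.sum_univ_succ, Finset.sum_eq_zero, add_zero]
  · have h3 : (Matrix.of fun i j : Fin (n + 1) => preCoeff i (q j)).submatrix Fin.succ
        (Fin.succAbove 0) = Matrix.of fun i j : Fin n => (-1 : ℤ) ^ (i : ℕ) *
          (Matrix.of fun i j : Fin n => (-1 : ℤ) ^ (q j.succ) *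
            (Matrix.of fun i j : Fin n => pathCoeff i (q j.succ - 2)) i j) i j := by
      ext i j
      obtain ⟨x, hx⟩ := h2 j
      simp only [Matrix.submatrix_apply, Matrix.of_apply, Fin.zero_succAbove, Fin.val_succ, hx,
        preCoeff_succ_add_two, Nat.add_sub_cancel]
      ring
    rw [h3, Matrix.det_mul_column, Matrix.det_mul_row]
    simp only [Matrix.of_apply, Fin.val_zero, h0, preCoeff]
    rw [Finset.prod_pow_eq_pow_sum, Finset.prod_pow_eq_pow_sum, Finset.sum_add_distrib, pow_add]
    simp [mul_assoc]
  · intro j _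
    obtain ⟨x, hx⟩ := h2 j
    simp [hx, preCoeff]

/-- The positions before the last steps, if exactly the paths outside of `s` make a step up. The
positions are shifted by one. -/
def preStep {n : ℕ} (p : Fin n → ℕ) (s : Finset (Fin n)) (j : Fin n) : ℕ :=
  if j ∈ s then p j + 1 else p j

/-- Multilinear expansion according to the last steps of the paths. -/
lemma det_pathCoeff_eq_sum {n : ℕ} (p : Fin n → ℕ) :
    (Matrix.of fun i j : Fin n => pathCoeff i (p j)).det =
      ∑ s : Finset (Fin n), (-1) ^ sᶜ.card *
        (Matrix.of fun i j : Fin n => preCoeff i (preStep p s j)).det := by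
  rw [← Matrix.det_transpose]
  have h := (Matrix.detRowAlternating (n := Fin n) (R := ℤ)).toMultilinearMap.map_add_univ
    (fun (j i : Fin n) => preCoeff i (p j + 1)) (fun (j i : Fin n) => - preCoeff i (p j))
  have h1 : (Matrix.of fun i j : Fin n => pathCoeff i (p j)).transpose =
      (fun (j i : Fin n) => preCoeff i (p j + 1)) + (fun (j i : Fin n) => - preCoeff i (p j)) := by
    ext i j
    simp [pathCoeff, sub_eq_add_neg]
  rw [h1]
  refine h.trans (Finset.sum_congr rfl fun s _ => ?_)
  have h2 : s.piecewise (fun (j i : Fin n) => preCoeff i (p j + 1))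
      (fun (j i : Fin n) => - preCoeff i (p j)) =
      fun (j : Fin n) => (if j ∈ s then (1 : ℤ) else -1) •
        (fun i : Fin n => preCoeff i (preStep p s j)) := by
    ext j i
    by_cases hj : j ∈ s <;> simp [preStep, hj]
  rw [h2]
  refine ((Matrix.detRowAlternating (n := Fin n) (R := ℤ)).toMultilinearMap.map_smul_univ
    _ _).trans ?_
  rw [← Matrix.det_transpose (Matrix.of _), smul_eq_mul]
  congr 1
  rw [Finset.prod_ite, Finset.prod_const, Finset.prod_const, one_pow, one_mul]
  congr 2
  ext j
  simp

lemma IsTetIdeal.strictMono_targets {n : ℕ} {J : Finset (ℕ × ℕ × ℕ)} (hJ : IsTetIdeal n J) :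
    StrictMono (targets n J) := by
  rw [Fin.strictMono_iff_lt_succ]
  intro i
  unfold targets
  rcases n with _ | n
  · exact i.elim0
  refine Fin.cases ?_ (fun k => ?_) i
  · simp
  · rw [Fin.cons_succ, ← Fin.succ_castSucc, Fin.cons_succ]
    have := hJ.position_lt (r := k) (r' := k + 1) (by omega) (by omega)
    simpa using this

/-- For given targets, at most one choice of the last steps leads to the positions `p`. -/
lemma sum_ite_preStep {n : ℕ} (p t : Fin n → ℕ) (c : ℤ) :
    (∑ s : Finset (Fin n), if preStep p s = t then c else 0) =
      if ∀ j, t j = p j ∨ t j = p j + 1 then c else 0 := by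
  split_ifs with h
  · rw [Finset.sum_eq_single (Finset.univ.filter fun j => t j = p j + 1)]
    · rw [if_pos]
      ext j
      have := h j
      by_cases hj : t j = p j + 1 <;> simp [preStep, hj]
      omega
    · intro s _ hs
      rw [if_neg]
      intro hst
      apply hs
      ext j
      rw [← hst]
      by_cases hj : j ∈ s <;> simp [preStep, hj]
    · simp
  · refine Finset.sum_eq_zero fun s _ => ?_
    rw [if_neg]
    intro hst
    apply h
    intro j
    rw [← hst]
    by_cases hj : j ∈ s <;> simp [preStep, hj]

/-- The signed number of ideals with prescribed positions in the layer `d = 0` is a determinant of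
path numbers. This is an instance of the lemma of Lindström, Gessel and Viennot. -/
theorem sum_tetIdeals_eq_det (n : ℕ) : ∀ p : Fin n → ℕ, StrictMono p →
    ∑ I ∈ tetIdeals n with ∀ r : Fin n, position I r = p r, (-1 : ℤ) ^ I.card =
      (Matrix.of fun i j : Fin n => pathCoeff i (p j)).det := by
  induction n with
  | zero =>
    intro p _
    have : tetIdeals 0 = {∅} := by
      ext I
      rw [mem_tetIdeals, Finset.mem_singleton]
      constructor
      · intro h
        have := h.subset
        simpa [tetrahedron] using this
      · rintro rfl
        exact ⟨by simp, by simp⟩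
    simp [this]
  | succ n ih =>
    intro p hp
    rw [sum_tetIdeals_succ hp, det_pathCoeff_eq_sum, Finset.sum_filter]
    have h1 : ∀ J ∈ tetIdeals n, (if ∀ j, targets n J j = p j ∨ targets n J j = p j + 1 then
        (-1) ^ (∑ r : Fin (n + 1), (p r + r)) * (-1 : ℤ) ^ J.card else 0) =
        ∑ s : Finset (Fin (n + 1)), if preStep p s = targets n J then
          (-1) ^ (∑ r : Fin (n + 1), (p r + r)) * (-1 : ℤ) ^ J.card else 0 :=
      fun J _ => (sum_ite_preStep p (targets n J) _).symm
    rw [Finset.sum_congr rfl h1, Finset.sum_comm]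
    refine Finset.sum_congr rfl fun s _ => ?_
    have hmono : Monotone (preStep p s) := by
      intro a b hab
      rcases hab.eq_or_lt with rfl | hab
      · exact le_rfl
      have := hp hab
      unfold preStep
      split_ifs <;> omega
    by_cases hs : StrictMono (preStep p s) ∧ preStep p s 0 = 1
    · rw [det_preCoeff_succ hs.1 hs.2]
      have h2 : ∀ j : Fin n, 2 ≤ preStep p s j.succ := by
        intro j
        have := hs.1 (Fin.succ_pos j)
        omega
      rw [← ih (fun j => preStep p s j.succ - 2), Finset.sum_filter, ← mul_assoc, Finset.mul_sum]
      · refine Finset.sum_congr rfl fun J _ => ?_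
        have h3 : preStep p s = targets n J ↔
            ∀ r : Fin n, position J r = preStep p s r.succ - 2 := by
          rw [funext_iff, Fin.forall_fin_succ]
          simp only [targets, Fin.cons_zero, Fin.cons_succ, hs.2, true_and]
          refine forall_congr' fun r => ?_
          have := h2 r
          omega
        by_cases h4 : ∀ r : Fin n, position J r = preStep p s r.succ - 2
        · rw [if_pos (h3.2 h4), if_pos h4]
          congr 1
          have e1 : ∑ j, preStep p s j = ∑ j, p j + s.card := by
            have : ∀ j, preStep p s j = p j + if j ∈ s then 1 else 0 := by
              intro j; unfold preStep; split_ifs <;> rfl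
            simp [this, Finset.sum_add_distrib]
          have e2 : s.card + sᶜ.card = n + 1 := by
            rw [Finset.card_add_card_compl, Fintype.card_fin]
          rw [Fin.sum_univ_succ, hs.2] at e1
          rw [← pow_add, Finset.sum_add_distrib, Finset.sum_add_distrib, Fin.sum_univ_castSucc
            (fun r : Fin (n + 1) => (r : ℕ))]
          simp only [Fin.val_castSucc, Fin.val_last]
          congr 1
          omega
        · rw [if_neg (fun h => h4 (h3.1 h)), if_neg h4, mul_zero]
      · intro a b hab
        have := hs.1 (Fin.succ_lt_succ_iff.2 hab)
        have := h2 a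
        simp only
        omega
    · rw [det_preCoeff_eq_zero hmono hs, mul_zero]
      refine Finset.sum_eq_zero fun J hJ => ?_
      rw [if_neg]
      intro h
      rw [h] at hs
      exact hs ⟨(mem_tetIdeals.1 hJ).strictMono_targets, rfl⟩

/-- The signed enumeration of the ideals is a sum of maximal minors, as the end points are free. -/
theorem sum_tetIdeals (n : ℕ) : ∑ I ∈ tetIdeals n, (-1 : ℤ) ^ I.card =
    ∑ p : Fin n → Fin (n * 2) with StrictMono p,
      (Matrix.of fun i j : Fin n => pathCoeff i (p j)).det := by
  have hb : ∀ (I : Finset (ℕ × ℕ × ℕ)) (r : Fin n), position I r < n * 2 := by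
    intro I r
    have := position_le I r
    omega
  rw [← Finset.sum_fiberwise_of_maps_to (s := tetIdeals n)
    (t := Finset.univ.filter fun p : Fin n → Fin (n * 2) => StrictMono p)
    (g := fun I r => ⟨position I r, hb I r⟩)]
  · refine Finset.sum_congr rfl fun p hp => ?_
    rw [← sum_tetIdeals_eq_det n (fun r => (p r : ℕ)) fun a b hab => (Finset.mem_filter.1 hp).2 hab]
    refine Finset.sum_congr ?_ fun _ _ => rfl
    ext I
    simp [funext_iff, Fin.ext_iff]
  · intro I hI
    rw [Finset.mem_filter]
    exact ⟨Finset.mem_univ _, fun a b hab => (mem_tetIdeals.1 hI).position_lt hab b.2⟩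

/-! ### From plane partitions to order ideals -/

/-- The smallest of three numbers. -/
def low (i j k : ℕ) : ℕ := min i (min j k)

/-- The middle one of three numbers. -/
def mid (i j k : ℕ) : ℕ := max (min i j) (min (max i j) k)

/-- The largest of three numbers. -/
def high (i j k : ℕ) : ℕ := max i (max j k)

lemma mem_box {n i j k : ℕ} :
    (i, j, k) ∈ box n n n ↔ (1 ≤ i ∧ i ≤ n) ∧ (1 ≤ j ∧ j ≤ n) ∧ (1 ≤ k ∧ k ≤ n) := by
  simp [box]

lemma mem_tsscpp {α : ℕ} {P : Finset (ℕ × ℕ × ℕ)} : P ∈ tsscpp α ↔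
    P ⊆ box (2 * α) (2 * α) (2 * α) ∧ IsPlanePartition P ∧ IsTotallySymmetricPP P ∧
      IsSelfComplementaryPP (2 * α) (2 * α) (2 * α) P := by
  simp [tsscpp]

lemma sorted_cases (i j k : ℕ) : (low i j k, mid i j k, high i j k) = (i, j, k) ∨
    (low i j k, mid i j k, high i j k) = (i, k, j) ∨
    (low i j k, mid i j k, high i j k) = (j, i, k) ∨
    (low i j k, mid i j k, high i j k) = (j, k, i) ∨
    (low i j k, mid i j k, high i j k) = (k, i, j) ∨
    (low i j k, mid i j k, high i j k) = (k, j, i) := by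
  simp only [low, mid, high, Prod.mk.injEq]
  omega

lemma IsTotallySymmetricPP.mem_iff_sorted {P : Finset (ℕ × ℕ × ℕ)} (h : IsTotallySymmetricPP P)
    (i j k : ℕ) : (i, j, k) ∈ P ↔ (low i j k, mid i j k, high i j k) ∈ P := by
  have h1 : ∀ i j k, (i, j, k) ∈ P ↔ (j, i, k) ∈ P := fun i j k => ⟨h.1 i j k, h.1 j i k⟩
  have h2 : ∀ i j k, (i, j, k) ∈ P ↔ (j, k, i) ∈ P :=
    fun i j k => ⟨h.2 i j k, fun h3 => h.2 _ _ _ (h.2 _ _ _ h3)⟩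
  rcases sorted_cases i j k with e | e | e | e | e | e <;> rw [e]
  · rw [h2, h1, h2, h2]
  · exact h1 _ _ _
  · exact h2 _ _ _
  · rw [h2, h2]
  · rw [h2, h1]

/-- The complementary cube of a cube of a totally symmetric self-complementary plane partition,
with the coordinates reversed: it carries the complementary sorted triple. -/
lemma mem_iff_reverse_notMem {α : ℕ} {P : Finset (ℕ × ℕ × ℕ)} (hP : P ∈ tsscpp α) {i j k : ℕ}
    (h : (i, j, k) ∈ box (2 * α) (2 * α) (2 * α)) :
    (i, j, k) ∈ P ↔ (2 * α + 1 - k, 2 * α + 1 - j, 2 * α + 1 - i) ∉ P := by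
  obtain ⟨-, -, hs, hc⟩ := mem_tsscpp.1 hP
  rw [hc i j k h, not_iff_not, hs.mem_iff_sorted,
    hs.mem_iff_sorted (2 * α + 1 - k) (2 * α + 1 - j) (2 * α + 1 - i)]
  have e : (low (2 * α + 1 - i) (2 * α + 1 - j) (2 * α + 1 - k),
      mid (2 * α + 1 - i) (2 * α + 1 - j) (2 * α + 1 - k),
      high (2 * α + 1 - i) (2 * α + 1 - j) (2 * α + 1 - k)) =
      (low (2 * α + 1 - k) (2 * α + 1 - j) (2 * α + 1 - i),
      mid (2 * α + 1 - k) (2 * α + 1 - j) (2 * α + 1 - i),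
      high (2 * α + 1 - k) (2 * α + 1 - j) (2 * α + 1 - i)) := by
    simp only [low, mid, high, Prod.mk.injEq]
    omega
  rw [e]

/-- The cubes of a self-complementary partition with at least two coordinates larger than `α`,
one from each half orbit, as a subset of a tetrahedron. -/
def core (α : ℕ) (P : Finset (ℕ × ℕ × ℕ)) : Finset (ℕ × ℕ × ℕ) :=
  (tetrahedron (α - 1)).filter fun x =>
    (α - 1 - x.1, α + x.2.1 + 1, α + x.2.1 + x.2.2 + 1) ∈ P

lemma mem_core {α r b d : ℕ} {P : Finset (ℕ × ℕ × ℕ)} : (r, b, d) ∈ core α P ↔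
    (b + d ≤ r ∧ r < α - 1) ∧ (α - 1 - r, α + b + 1, α + b + d + 1) ∈ P := by
  simp [core, mem_tetrahedron]

/-- The sorted triple `(i, j, k)` belongs to the half orbits encoded by `I`. -/
def Encoded (α : ℕ) (I : Finset (ℕ × ℕ × ℕ)) (i j k : ℕ) : Prop :=
  α < j ∧ i < α ∧ (α - 1 - i, j - α - 1, k - j) ∈ I

/-- Membership of the sorted triple `(i, j, k)` in the partition encoded by `I`: if the middle
coordinate is at most `α`, it is decided by the complementary triple. -/
def EncodedPart (α : ℕ) (I : Finset (ℕ × ℕ × ℕ)) (i j k : ℕ) : Prop :=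
  Encoded α I i j k ∨ (j ≤ α ∧ ¬ Encoded α I (2 * α + 1 - k) (2 * α + 1 - j) (2 * α + 1 - i))

open Classical in
/-- The totally symmetric self-complementary plane partition with a given core. -/
noncomputable def ofCore (α : ℕ) (I : Finset (ℕ × ℕ × ℕ)) : Finset (ℕ × ℕ × ℕ) :=
  (box (2 * α) (2 * α) (2 * α)).filter fun x =>
    EncodedPart α I (low x.1 x.2.1 x.2.2) (mid x.1 x.2.1 x.2.2) (high x.1 x.2.1 x.2.2)

lemma mem_ofCore {α i j k : ℕ} {I : Finset (ℕ × ℕ × ℕ)} : (i, j, k) ∈ ofCore α I ↔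
    (i, j, k) ∈ box (2 * α) (2 * α) (2 * α) ∧
      EncodedPart α I (low i j k) (mid i j k) (high i j k) := by
  simp only [ofCore, Finset.mem_filter]

/-- This inequality makes an encoded triple incompatible with every encoded complementary triple. -/
lemma Encoded.add_le {α : ℕ} {I : Finset (ℕ × ℕ × ℕ)} (hI : IsTetIdeal (α - 1) I) {i j k : ℕ}
    (hjk : j ≤ k) (h : Encoded α I i j k) : i + k ≤ 2 * α := by
  obtain ⟨h1, h2, h3⟩ := h
  have := hI.bounds h3
  omega

lemma Encoded.mono {α : ℕ} {I : Finset (ℕ × ℕ × ℕ)} (hI : IsTetIdeal (α - 1) I)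
    {i j k i' j' k' : ℕ} (hjk : j ≤ k) (hjk' : j' ≤ k') (h : Encoded α I i j k) (hi : 1 ≤ i')
    (hi' : i' ≤ i) (hj : α < j') (hj' : j' ≤ j) (hk : k' ≤ k) : Encoded α I i' j' k' := by
  obtain ⟨h1, h2, h3⟩ := h
  have := hI.bounds h3
  exact ⟨hj, by omega, hI.down _ _ _ _ _ _ h3 (by omega) (by omega) (by omega) (by omega)⟩

lemma EncodedPart.mono {α : ℕ} {I : Finset (ℕ × ℕ × ℕ)} (hI : IsTetIdeal (α - 1) I)
    {i j k i' j' k' : ℕ} (hij : i ≤ j) (hjk : j ≤ k) (hij' : i' ≤ j') (hjk' : j' ≤ k')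
    (h : EncodedPart α I i j k) (hi : 1 ≤ i') (hi' : i' ≤ i) (hj' : j' ≤ j) (hk : k' ≤ k)
    (hk2 : k ≤ 2 * α) : EncodedPart α I i' j' k' := by
  rcases h with h | ⟨hj, h⟩
  · have h1 := h.add_le hI hjk
    rcases lt_or_ge α j' with h2 | h2
    · exact Or.inl (h.mono hI hjk hjk' hi hi' h2 hj' hk)
    · refine Or.inr ⟨h2, fun h3 => ?_⟩
      have := h3.add_le hI (by omega)
      omega
  · refine Or.inr ⟨by omega, fun h3 => h ?_⟩
    exact h3.mono hI (by omega) (by omega) (by omega) (by omega) (by omega) (by omega) (by omega)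

lemma ofCore_mem_tsscpp {α : ℕ} {I : Finset (ℕ × ℕ × ℕ)} (hI : IsTetIdeal (α - 1) I) :
    ofCore α I ∈ tsscpp α := by
  rw [mem_tsscpp]
  refine ⟨fun ⟨i, j, k⟩ h => (mem_ofCore.1 h).1, ⟨?_, ?_⟩, ⟨?_, ?_⟩, ?_⟩
  · intro i j k h
    have := mem_box.1 (mem_ofCore.1 h).1
    omega
  · intro i j k i' j' k' h h1 h2 h3 h4 h5 h6
    rw [mem_ofCore] at h ⊢
    have hb := mem_box.1 h.1
    refine ⟨mem_box.2 (by omega), h.2.mono hI ?_ ?_ ?_ ?_ ?_ ?_ ?_ ?_ ?_⟩ <;>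
      simp only [low, mid, high] <;> omega
  · intro i j k h
    rw [mem_ofCore, mem_box] at h ⊢
    refine ⟨by omega, ?_⟩
    rw [show low j i k = low i j k by unfold low; omega,
      show mid j i k = mid i j k by unfold mid; omega,
      show high j i k = high i j k by unfold high; omega]
    exact h.2
  · intro i j k h
    rw [mem_ofCore, mem_box] at h ⊢
    refine ⟨by omega, ?_⟩
    rw [show low j k i = low i j k by unfold low; omega,
      show mid j k i = mid i j k by unfold mid; omega,
      show high j k i = high i j k by unfold high; omega]
    exact h.2
  · intro i j k h
    have hb := mem_box.1 h
    rw [mem_ofCore, mem_ofCore, mem_box, mem_box]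
    rw [show low (2 * α + 1 - i) (2 * α + 1 - j) (2 * α + 1 - k) = 2 * α + 1 - high i j k by
        unfold low high; omega,
      show mid (2 * α + 1 - i) (2 * α + 1 - j) (2 * α + 1 - k) = 2 * α + 1 - mid i j k by
        unfold mid; omega,
      show high (2 * α + 1 - i) (2 * α + 1 - j) (2 * α + 1 - k) = 2 * α + 1 - low i j k by
        unfold low high; omega]
    have hl : low i j k ≤ 2 * α := by unfold low; omega
    have hm : mid i j k ≤ 2 * α := by unfold mid; omega
    have hh : high i j k ≤ 2 * α := by unfold high; omega
    generalize low i j k = x at *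
    generalize mid i j k = y at *
    generalize high i j k = z at *
    rw [and_iff_right hb, and_iff_right (by omega)]
    unfold EncodedPart
    rw [show 2 * α + 1 - (2 * α + 1 - x) = x by omega, show 2 * α + 1 - (2 * α + 1 - y) = y by omega,
      show 2 * α + 1 - (2 * α + 1 - z) = z by omega]
    rcases lt_or_ge α y with hy | hy
    · have h1 : ¬ Encoded α I (2 * α + 1 - z) (2 * α + 1 - y) (2 * α + 1 - x) := by
        rintro ⟨h1, -⟩; omega
      have h2 : 2 * α + 1 - y ≤ α := by omega
      have h3 : ¬ y ≤ α := by omega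
      simp [h1, h2, h3]
    · have h1 : ¬ Encoded α I x y z := by
        rintro ⟨h1, -⟩; omega
      have h2 : ¬ 2 * α + 1 - y ≤ α := by omega
      simp [h1, h2, hy]

lemma isTetIdeal_core {α : ℕ} {P : Finset (ℕ × ℕ × ℕ)} (hP : P ∈ tsscpp α) :
    IsTetIdeal (α - 1) (core α P) where
  subset := Finset.filter_subset _ _
  down r b d r' b' d' h h1 h2 h3 h4 := by
    rw [mem_core] at h ⊢
    exact ⟨by omega, (mem_tsscpp.1 hP).2.1.down _ _ _ _ _ _ h.2 (by omega) (by omega) (by omega)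
      (by omega) (by omega) (by omega)⟩

lemma core_ofCore {α : ℕ} {I : Finset (ℕ × ℕ × ℕ)} (hI : IsTetIdeal (α - 1) I) :
    core α (ofCore α I) = I := by
  ext ⟨r, b, d⟩
  rw [mem_core, mem_ofCore, mem_box]
  have key : r < α - 1 → (EncodedPart α I (low (α - 1 - r) (α + b + 1) (α + b + d + 1))
      (mid (α - 1 - r) (α + b + 1) (α + b + d + 1))
      (high (α - 1 - r) (α + b + 1) (α + b + d + 1)) ↔ (r, b, d) ∈ I) := by
    intro h
    rw [show low (α - 1 - r) (α + b + 1) (α + b + d + 1) = α - 1 - r by unfold low; omega,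
      show mid (α - 1 - r) (α + b + 1) (α + b + d + 1) = α + b + 1 by unfold mid; omega,
      show high (α - 1 - r) (α + b + 1) (α + b + d + 1) = α + b + d + 1 by unfold high; omega]
    unfold EncodedPart Encoded
    rw [show α - 1 - (α - 1 - r) = r by omega, show α + b + 1 - α - 1 = b by omega,
      show α + b + d + 1 - (α + b + 1) = d by omega]
    constructor
    · rintro (h1 | h1)
      · exact h1.2.2
      · omega
    · intro h1
      exact Or.inl ⟨by omega, by omega, h1⟩
  constructor
  · rintro ⟨h1, -, h3⟩
    exact (key h1.2).1 h3
  · intro h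
    have := hI.bounds h
    exact ⟨this, by omega, (key this.2).2 h⟩

/-- A sorted triple of the partition with middle coordinate above `α` lies in the tetrahedron:
otherwise the partition would contain the complementary cube, too. -/
lemma add_le_of_mem_tsscpp {α : ℕ} {P : Finset (ℕ × ℕ × ℕ)} (hP : P ∈ tsscpp α) {i j k : ℕ}
    (hj : α < j) (h : (i, j, k) ∈ P) : i + k ≤ 2 * α := by
  obtain ⟨hbox, hpp, -, -⟩ := mem_tsscpp.1 hP
  by_contra hlt
  have hb := mem_box.1 (hbox h)
  exact (mem_iff_reverse_notMem hP (hbox h)).1 h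
    (hpp.down _ _ _ _ _ _ h (by omega) (by omega) (by omega) (by omega) (by omega) (by omega))

lemma encoded_core_iff {α : ℕ} {P : Finset (ℕ × ℕ × ℕ)} (hP : P ∈ tsscpp α) {i j k : ℕ}
    (hj : α < j) (hjk : j ≤ k) (hi : 1 ≤ i) : Encoded α (core α P) i j k ↔ (i, j, k) ∈ P := by
  unfold Encoded
  rw [mem_core]
  constructor
  · rintro ⟨h1, h2, h3, h4⟩
    rwa [show α - 1 - (α - 1 - i) = i by omega, show α + (j - α - 1) + 1 = j by omega,
      show α + (j - α - 1) + (k - j) + 1 = k by omega] at h4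
  · intro h
    have := add_le_of_mem_tsscpp hP hj h
    rw [show α - 1 - (α - 1 - i) = i by omega, show α + (j - α - 1) + 1 = j by omega,
      show α + (j - α - 1) + (k - j) + 1 = k by omega]
    exact ⟨hj, by omega, by omega, h⟩

lemma ofCore_core {α : ℕ} {P : Finset (ℕ × ℕ × ℕ)} (hP : P ∈ tsscpp α) :
    ofCore α (core α P) = P := by
  obtain ⟨hbox, -, hs, -⟩ := mem_tsscpp.1 hP
  ext ⟨i, j, k⟩
  rw [mem_ofCore, hs.mem_iff_sorted i j k]
  have key : (i, j, k) ∈ box (2 * α) (2 * α) (2 * α) →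
      (EncodedPart α (core α P) (low i j k) (mid i j k) (high i j k) ↔
        (low i j k, mid i j k, high i j k) ∈ P) := by
    intro h
    rw [mem_box] at h
    have h1 : low i j k ≤ mid i j k := by unfold low mid; omega
    have h2 : mid i j k ≤ high i j k := by unfold mid high; omega
    have h3 : 1 ≤ low i j k := by unfold low; omega
    have h4 : high i j k ≤ 2 * α := by unfold high; omega
    generalize low i j k = x at *
    generalize mid i j k = y at *
    generalize high i j k = z at *
    unfold EncodedPart
    rcases lt_or_ge α y with hy | hy
    · rw [encoded_core_iff hP hy h2 h3]
      simp [Nat.not_le.2 hy]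
    · rw [encoded_core_iff hP (j := 2 * α + 1 - y) (by omega) (by omega) (by omega),
        mem_iff_reverse_notMem hP (i := x) (mem_box.2 (by omega))]
      have h5 : ¬ Encoded α (core α P) x y z := by
        rintro ⟨h1, -⟩; omega
      simp [h5, hy]
  constructor
  · rintro ⟨h1, h2⟩
    exact (key h1).1 h2
  · intro h
    have h1 := hbox ((hs.mem_iff_sorted i j k).2 h)
    exact ⟨h1, (key h1).2 h⟩

lemma mem_halfOrbit {p q : ℕ × ℕ × ℕ} : q ∈ halfOrbit p ↔ q = (p.1, p.2.1, p.2.2) ∨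
    q = (p.2.1, p.2.2, p.1) ∨ q = (p.2.2, p.1, p.2.1) ∨ q = (p.2.1, p.1, p.2.2) ∨
    q = (p.1, p.2.2, p.2.1) ∨ q = (p.2.2, p.2.1, p.1) := by
  simp [halfOrbit]

lemma halfOrbit_sorted (i j k : ℕ) :
    halfOrbit (low i j k, mid i j k, high i j k) = halfOrbit (i, j, k) := by
  rcases sorted_cases i j k with e | e | e | e | e | e <;> rw [e] <;> ext q <;>
    simp only [mem_halfOrbit] <;> tauto

lemma halfOrbit_inj_of_sorted {i j k i' j' k' : ℕ} (hij : i ≤ j) (hjk : j ≤ k) (hij' : i' ≤ j')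
    (hjk' : j' ≤ k') (h : halfOrbit (i, j, k) = halfOrbit (i', j', k')) :
    i = i' ∧ j = j' ∧ k = k' := by
  have h1 : (i, j, k) ∈ halfOrbit (i', j', k') := h ▸ mem_halfOrbit.2 (Or.inl rfl)
  simp only [mem_halfOrbit, Prod.mk.injEq] at h1
  omega

lemma IsTotallySymmetricPP.halfOrbit_subset_iff {P : Finset (ℕ × ℕ × ℕ)}
    (hs : IsTotallySymmetricPP P) (p : ℕ × ℕ × ℕ) : halfOrbit p ⊆ P ↔ p ∈ P := by
  constructor
  · intro h
    exact h (mem_halfOrbit.2 (Or.inl rfl))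
  · intro h q hq
    obtain ⟨i, j, k⟩ := p
    rw [mem_halfOrbit] at hq
    have h1 := hs.2 _ _ _ h
    rcases hq with rfl | rfl | rfl | rfl | rfl | rfl
    · exact h
    · exact h1
    · exact hs.2 _ _ _ h1
    · exact hs.1 _ _ _ h
    · exact hs.1 _ _ _ (hs.2 _ _ _ h1)
    · exact hs.1 _ _ _ h1

lemma mem_referencePartition {α i j k : ℕ} : (i, j, k) ∈ referencePartition α ↔
    (i, j, k) ∈ box (2 * α) (2 * α) (2 * α) ∧ mid i j k ≤ α := by
  simp only [referencePartition, Finset.mem_filter, mid]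
  refine and_congr_right fun _ => ?_
  omega

lemma isTotallySymmetricPP_referencePartition (α : ℕ) :
    IsTotallySymmetricPP (referencePartition α) := by
  constructor <;> intro i j k h <;> rw [mem_referencePartition, mem_box] at h ⊢ <;>
    unfold mid at * <;> omega

/-- Each half orbit outside of the reference partition has exactly one sorted representative, and
the middle coordinate of the latter exceeds `α`. -/
lemma halfOrbitCount_eq {α : ℕ} {P : Finset (ℕ × ℕ × ℕ)} (hP : P ∈ tsscpp α) :
    halfOrbitCount α P = (core α P).card := by
  obtain ⟨hbox, -, hs, -⟩ := mem_tsscpp.1 hP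
  unfold halfOrbitCount
  symm
  refine Finset.card_bij (fun x _ => halfOrbit (α - 1 - x.1, α + x.2.1 + 1,
    α + x.2.1 + x.2.2 + 1)) ?_ ?_ ?_
  · rintro ⟨r, b, d⟩ h
    rw [mem_core] at h
    rw [Finset.mem_filter, hs.halfOrbit_subset_iff,
      (isTotallySymmetricPP_referencePartition α).halfOrbit_subset_iff, mem_referencePartition]
    refine ⟨Finset.mem_image_of_mem _ (hbox h.2), h.2, fun h1 => ?_⟩
    unfold mid at h1
    omega
  · rintro ⟨r, b, d⟩ h ⟨r', b', d'⟩ h' heq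
    rw [mem_core] at h h'
    have := halfOrbit_inj_of_sorted (by omega) (by omega) (by omega) (by omega) heq
    obtain ⟨rfl, rfl, rfl⟩ : r = r' ∧ b = b' ∧ d = d' := by
      dsimp only at this
      omega
    rfl
  · intro o ho
    rw [Finset.mem_filter, Finset.mem_image] at ho
    obtain ⟨⟨⟨i, j, k⟩, hb, rfl⟩, h1, h2⟩ := ho
    rw [hs.halfOrbit_subset_iff] at h1
    rw [(isTotallySymmetricPP_referencePartition α).halfOrbit_subset_iff, mem_referencePartition,
      and_iff_right hb] at h2
    rw [hs.mem_iff_sorted] at h1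
    rw [mem_box] at hb
    rw [← halfOrbit_sorted]
    have h3 : low i j k ≤ mid i j k := by unfold low mid; omega
    have h4 : mid i j k ≤ high i j k := by unfold mid high; omega
    have h5 : 1 ≤ low i j k := by unfold low; omega
    have h6 := (encoded_core_iff hP (by omega) h4 h5).2 h1
    generalize low i j k = x at *
    generalize mid i j k = y at *
    generalize high i j k = z at *
    refine ⟨_, h6.2.2, ?_⟩
    have := h6.2.1
    simp only
    rw [show α - 1 - (α - 1 - x) = x by omega, show α + (y - α - 1) + 1 = y by omega,
      show α + (y - α - 1) + (z - y) + 1 = z by omega]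

/-- Totally symmetric self-complementary plane partitions correspond to ideals of a tetrahedron. -/
theorem signedEnumTSSCPP_eq (α : ℕ) :
    signedEnumTSSCPP α = ∑ I ∈ tetIdeals (α - 1), (-1 : ℤ) ^ I.card := by
  unfold signedEnumTSSCPP
  refine Finset.sum_bij' (fun P _ => core α P) (fun I _ => ofCore α I) ?_ ?_ ?_ ?_ ?_
  · exact fun P hP => mem_tetIdeals.2 (isTetIdeal_core hP)
  · exact fun I hI => ofCore_mem_tsscpp (mem_tetIdeals.1 hI)
  · exact fun P hP => ofCore_core hP
  · exact fun I hI => core_ofCore (mem_tetIdeals.1 hI)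
  · exact fun P hP => by rw [halfOrbitCount_eq hP]

/-! ### The parity structure of the path polynomials -/

/-- The coefficient of `u ^ k` in `u ^ l * (1 - u) ^ l`. -/
def evenCoeff (l k : ℕ) : ℤ := if l ≤ k then (-1) ^ (k + l) * (l.choose (k - l) : ℤ) else 0

/-- The coefficient of `u ^ k` in `u ^ l * (1 - u) ^ (l + 1)`. -/
def oddCoeff (l k : ℕ) : ℤ := if l ≤ k then (-1) ^ (k + l) * ((l + 1).choose (k - l) : ℤ) else 0

lemma oddCoeff_zero_right (l : ℕ) : oddCoeff l 0 = evenCoeff l 0 := by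
  rcases l with _ | l <;> simp [oddCoeff, evenCoeff]

lemma oddCoeff_succ_right (l k : ℕ) : oddCoeff l (k + 1) = evenCoeff l (k + 1) - evenCoeff l k := by
  unfold oddCoeff evenCoeff
  rcases lt_trichotomy l (k + 1) with h | rfl | h
  · obtain ⟨d, rfl⟩ := Nat.exists_eq_add_of_le (Nat.lt_succ_iff.1 h)
    rw [if_pos (by omega), if_pos (by omega), if_pos (by omega),
      show l + d + 1 - l = d + 1 by omega, show l + d - l = d by omega, Nat.choose_succ_succ]
    push_cast
    ring
  · simp
  · rw [if_neg (by omega), if_neg (by omega), if_neg (by omega), sub_zero]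

lemma evenCoeff_succ_succ (l k : ℕ) : evenCoeff (l + 1) (k + 1) = oddCoeff l k := by
  unfold oddCoeff evenCoeff
  by_cases h : l ≤ k
  · rw [if_pos (by omega), if_pos h, Nat.add_sub_add_right,
      show k + 1 + (l + 1) = k + l + 2 by ring, pow_add]
    simp
  · rw [if_neg (by omega), if_neg h]

lemma preCoeff_odd {l : ℕ} (h : ∀ k, pathCoeff (2 * l) (2 * k) = evenCoeff l k ∧
    pathCoeff (2 * l) (2 * k + 1) = - evenCoeff l k) (k : ℕ) :
    preCoeff (2 * l + 1) (2 * k + 2) = evenCoeff l k ∧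
      preCoeff (2 * l + 1) (2 * k + 3) = evenCoeff l k := by
  constructor
  · rw [preCoeff_succ_add_two, (h k).1, ← mul_add, pow_mul]
    simp
  · rw [show 2 * k + 3 = (2 * k + 1) + 2 by ring, preCoeff_succ_add_two, (h k).2,
      ← add_assoc, ← mul_add, pow_succ, pow_mul]
    simp

lemma pathCoeff_odd_of_even {l : ℕ} (h : ∀ k, pathCoeff (2 * l) (2 * k) = evenCoeff l k ∧
    pathCoeff (2 * l) (2 * k + 1) = - evenCoeff l k) (k : ℕ) :
    pathCoeff (2 * l + 1) (2 * k) = 0 ∧ pathCoeff (2 * l + 1) (2 * k + 1) = oddCoeff l k := by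
  rw [pathCoeff, pathCoeff, (preCoeff_odd h k).1]
  rcases k with _ | k
  · rw [oddCoeff_zero_right]
    simp [preCoeff]
  · rw [show 2 * (k + 1) + 1 = 2 * k + 3 by ring, (preCoeff_odd h k).2,
      show 2 * (k + 1) = 2 * k + 2 by ring, (preCoeff_odd h k).1, oddCoeff_succ_right]
    simp

/-- The polynomial with even index `2 * l` is `(1 - X) * g (X ^ 2)` with `g = u ^ l * (1 - u) ^ l`. -/
lemma pathCoeff_even (l : ℕ) : ∀ k, pathCoeff (2 * l) (2 * k) = evenCoeff l k ∧
    pathCoeff (2 * l) (2 * k + 1) = - evenCoeff l k := by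
  have key : ∀ l : ℕ, (∀ k, preCoeff (2 * l) (2 * k + 1) = evenCoeff l k ∧
      preCoeff (2 * l) (2 * k) = 0) → ∀ k, pathCoeff (2 * l) (2 * k) = evenCoeff l k ∧
      pathCoeff (2 * l) (2 * k + 1) = - evenCoeff l k := by
    intro l h k
    rw [pathCoeff, pathCoeff, (h k).1, (h k).2, show 2 * k + 1 + 1 = 2 * (k + 1) by ring,
      (h (k + 1)).2]
    simp
  induction l with
  | zero =>
    refine key 0 fun k => ?_
    rcases k with _ | k
    · simp [preCoeff, evenCoeff]
    · simp only [preCoeff]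
      rw [if_neg (by omega), if_neg (by omega)]
      simp [evenCoeff]
  | succ l ih =>
    refine key (l + 1) fun k => ?_
    rw [show 2 * (l + 1) = 2 * l + 1 + 1 by ring]
    rcases k with _ | k
    · simp [preCoeff, evenCoeff]
    · rw [show 2 * (k + 1) + 1 = 2 * k + 1 + 2 by ring, show 2 * (k + 1) = 2 * k + 2 by ring,
        preCoeff_succ_add_two, preCoeff_succ_add_two, (pathCoeff_odd_of_even ih k).1,
        (pathCoeff_odd_of_even ih k).2, evenCoeff_succ_succ, mul_zero,
        show 2 * l + 1 + (2 * k + 1) = 2 * (l + k + 1) by ring, pow_mul]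
      simp

/-- The polynomial with odd index `2 * l + 1` is `X * e (X ^ 2)` with
`e = u ^ l * (1 - u) ^ (l + 1)`. -/
lemma pathCoeff_odd (l k : ℕ) :
    pathCoeff (2 * l + 1) (2 * k) = 0 ∧ pathCoeff (2 * l + 1) (2 * k + 1) = oddCoeff l k :=
  pathCoeff_odd_of_even (pathCoeff_even l) k

/-- The Vandermonde convolution. -/
lemma sum_evenCoeff_mul_oddCoeff {i K : ℕ} (j : ℕ) (hi : 2 * i < K) :
    ∑ k ∈ Finset.range K, (evenCoeff i k * oddCoeff j k : ℚ) =
      (-1) ^ i * ((-1) ^ j * skewBinom i j) := by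
  unfold skewBinom
  split_ifs with hj
  · obtain ⟨d, hd⟩ := Nat.exists_eq_add_of_le hj
    obtain ⟨e, rfl⟩ := Nat.exists_eq_add_of_le (show j + (d + 1) ≤ K by omega)
    rw [Finset.sum_range_add, Finset.sum_range_add, Finset.sum_eq_zero, zero_add,
      Finset.sum_eq_zero (s := Finset.range e), add_zero]
    · rw [show 2 * i - j = d by omega, show i + j + 1 = (j + 1) + i by ring, Nat.add_choose_eq,
        Finset.Nat.sum_antidiagonal_eq_sum_range_succ_mk]
      push_cast
      rw [Finset.mul_sum, Finset.mul_sum]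
      refine Finset.sum_congr rfl fun y hy => ?_
      rw [Finset.mem_range] at hy
      simp only [oddCoeff, Nat.le_add_right, if_true, Nat.add_sub_cancel_left, evenCoeff]
      split_ifs with h
      · obtain ⟨x, hx⟩ := Nat.exists_eq_add_of_le h
        have h1 : d - y = i - (j + y - i) := by omega
        have hs : ((-1 : ℚ) ^ (j + y)) * (-1) ^ (j + y) = 1 := by
          rw [← mul_pow]; simp
        rw [h1, Nat.choose_symm (by omega), pow_add (-1 : ℤ) (j + y) i, pow_add (-1 : ℤ) (j + y) j]
        push_cast
        linear_combination ((-1) ^ i * (-1) ^ j * (i.choose (j + y - i) : ℚ) *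
          ((j + 1).choose y : ℚ)) * hs
      · rw [Nat.choose_eq_zero_of_lt (n := i) (k := d - y) (by omega)]
        simp
    · intro x _
      rw [evenCoeff, if_pos (by omega), Nat.choose_eq_zero_of_lt (by omega)]
      simp
    · intro k hk
      rw [Finset.mem_range] at hk
      simp [oddCoeff, Nat.not_le.2 hk]
  · rw [mul_zero, mul_zero]
    refine Finset.sum_eq_zero fun k _ => ?_
    rcases lt_or_ge k j with h | h
    · simp [oddCoeff, Nat.not_le.2 h]
    · rw [evenCoeff, if_pos (by omega), Nat.choose_eq_zero_of_lt (by omega)]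
      simp

/-- The numbering of the even rows `2 * a` and of the odd rows `2 * b + 1`. -/
noncomputable def parityEquiv (n m : ℕ) (hmn : m ≤ n) (hnm : n ≤ m + 1) :
    Fin n ⊕ Fin m ≃ Fin (n + m) :=
  Equiv.ofBijective (Sum.elim (fun a => ⟨2 * a, by omega⟩) (fun b => ⟨2 * b + 1, by omega⟩)) <| by
    rw [Fintype.bijective_iff_injective_and_card]
    refine ⟨?_, by simp⟩
    rintro (a | a) (b | b) h <;> simp [Fin.ext_iff] at h ⊢ <;> omega

lemma parityEquiv_inl {n m : ℕ} (hmn : m ≤ n) (hnm : n ≤ m + 1) (a : Fin n) :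
    (parityEquiv n m hmn hnm (Sum.inl a) : ℕ) = 2 * a := rfl

lemma parityEquiv_inr {n m : ℕ} (hmn : m ≤ n) (hnm : n ≤ m + 1) (b : Fin m) :
    (parityEquiv n m hmn hnm (Sum.inr b) : ℕ) = 2 * b + 1 := rfl

lemma strictMono_elim_comp_parityEquiv_symm {n : ℕ} {μ : Fin n → ℕ} (hμ : StrictMono μ) :
    StrictMono (Sum.elim (fun a => 2 * μ a) (fun b => 2 * μ b + 1) ∘
      (parityEquiv n n le_rfl (Nat.le_succ n)).symm) := by
  intro i j hij
  obtain ⟨x, rfl⟩ := (parityEquiv n n le_rfl (Nat.le_succ n)).surjective i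
  obtain ⟨y, rfl⟩ := (parityEquiv n n le_rfl (Nat.le_succ n)).surjective j
  rw [Fin.lt_def] at hij
  simp only [Function.comp_apply, Equiv.symm_apply_apply]
  rcases x with x | x <;> rcases y with y | y <;>
    simp only [parityEquiv_inl, parityEquiv_inr, Sum.elim_inl, Sum.elim_inr] at hij ⊢
  · have := hμ (a := x) (b := y) (by omega)
    omega
  · have := hμ.monotone (a := x) (b := y) (by omega)
    omega
  · have := hμ (a := x) (b := y) (by omega)
    omega
  · have := hμ (a := x) (b := y) (by omega)
    omega

lemma sum_tetIdeals_eq_sum_pairSign {n m : ℕ} (hmn : m ≤ n) (hnm : n ≤ m + 1) :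
    ∑ I ∈ tetIdeals (n + m), (-1 : ℤ) ^ I.card =
      ∑ κ : Fin n → Fin (n + m), ∑ μ : Fin m → Fin (n + m),
        (∏ a : Fin n, evenCoeff a (κ a)) * (∏ b : Fin m, oddCoeff b (μ b)) *
        pairSign (parityEquiv n m hmn hnm) (fun a => (κ a : ℕ)) (fun b => (μ b : ℕ)) := by
  rw [sum_tetIdeals]
  have h := sum_det_eq_sum_pairSign (parityEquiv n m hmn hnm) (n + m)
    (fun i k => pathCoeff i k)
    (fun a k => by rw [parityEquiv_inl, (pathCoeff_even a k).1, (pathCoeff_even a k).2])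
    (fun b k => by rw [parityEquiv_inr, (pathCoeff_odd b k).1])
  rw [h]
  simp only [parityEquiv_inl, parityEquiv_inr, pathCoeff_even, pathCoeff_odd]

/-- There is one even row more than there are odd rows, so not all even rows can be matched. -/
theorem sum_tetIdeals_odd (m : ℕ) : ∑ I ∈ tetIdeals (m + 1 + m), (-1 : ℤ) ^ I.card = 0 := by
  rw [sum_tetIdeals_eq_sum_pairSign (Nat.le_succ m) le_rfl]
  refine Finset.sum_eq_zero fun κ _ => Finset.sum_eq_zero fun μ _ => ?_
  rw [pairSign_eq_zero_of_card_lt _ (by simp), mul_zero]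

theorem sum_tetIdeals_even (n : ℕ) :
    ((∑ I ∈ tetIdeals (n + n), (-1 : ℤ) ^ I.card : ℤ) : ℚ) = (mrrMatrix n).det := by
  rw [sum_tetIdeals_eq_sum_pairSign le_rfl (Nat.le_succ n)]
  simp_rw [pairSign_eq_det _ fun μ hμ => strictMono_elim_comp_parityEquiv_symm hμ]
  rw [sum_prod_mul_det_ite (fun i k => evenCoeff i k) (fun j k => oddCoeff j k)]
  have h1 : ((Matrix.of fun i j : Fin n => ∑ k : Fin (n + n), evenCoeff i k * oddCoeff j k).map
      (Int.castRingHom ℚ)) = Matrix.of fun i j : Fin n => (-1 : ℚ) ^ (i : ℕ) *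
        (Matrix.of fun i j : Fin n => (-1 : ℚ) ^ (j : ℕ) * mrrMatrix n i j) i j := by
    ext i j
    simp only [Matrix.map_apply, Matrix.of_apply, mrrMatrix]
    rw [← sum_evenCoeff_mul_oddCoeff (K := n + n) j (by omega)]
    rw [Finset.sum_range]
    simp
  have h2 := (Int.castRingHom ℚ).map_det
    (Matrix.of fun i j : Fin n => ∑ k : Fin (n + n), evenCoeff i k * oddCoeff j k)
  rw [RingHom.mapMatrix_apply, h1, Matrix.det_mul_column, Matrix.det_mul_row, ← mul_assoc,
    ← Finset.prod_mul_distrib, Finset.prod_eq_one, one_mul] at h2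
  · exact h2
  · intro i _
    rw [← mul_pow]
    simp

theorem theorem5 (α : ℕ) (hα : 1 ≤ α) :
    (Odd α → (signedEnumTSSCPP α : ℚ) =
      ∏ k ∈ Finset.Icc 1 ((α - 1) / 2),
        (Nat.factorial (6 * k - 2) : ℚ) / (Nat.factorial (2 * k + α - 1) : ℚ)) ∧
    (Even α → signedEnumTSSCPP α = 0) := by
  rw [signedEnumTSSCPP_eq]
  constructor
  · rintro ⟨n, rfl⟩
    rw [show 2 * n + 1 - 1 = n + n by omega, sum_tetIdeals_even, det_mrrMatrix,
      show (n + n) / 2 = n by omega]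
    refine Finset.prod_congr rfl fun k _ => ?_
    rw [show 2 * k + (2 * n + 1) - 1 = 2 * k + 2 * n by omega]
  · rintro ⟨n, rfl⟩
    obtain ⟨m, rfl⟩ : ∃ m, n = m + 1 := ⟨n - 1, by omega⟩
    rw [show m + 1 + (m + 1) - 1 = m + 1 + m by omega, sum_tetIdeals_odd]
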